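/- Let $n\ge 1$ and let $|\psi\rangle=\sum_{k=0}^{2^n-1}\psi_k|k\rangle$ be an $n$-qubit pure state, $\sum_k|\psi_k|^2=1$. Then $|\psi\rangle$ can be prepared exactly from $|0\rangle^{\otimes n}$ by a circuit on these $n$ qubits (without ancillas) that consists of C-NOT gates between arbitrary pairs of distinct qubits and arbitrary single-qubit unitary gates, and that uses at most $\frac{11}{12}2^n$ C-NOT gates. More precisely, for $n\ge 2$ every $n$-qubit state can be prepared by such a circuit with exactly $N_{\rm state}(n)$ C-NOT gates, where $$N_{\rm state}(n)=\frac{11}{12}\sum_{i=0}^{l-3}2^{\lfloor n/2^i\rfloor}-\sum_{i=0}^{l-3}c_i\,2^{\lfloor n/2^{i+1}\rfloor}+(n-\mathrm{popcount}(n)-1)+\sum_{i=0}^{l-3}d_i+\frac12 b(b-1),$$ and $N_{\rm state}(n)<\frac{11}{12}2^n$. Here $l=\lfloor\log_2 n\rfloor+1$ is the bit length of $n$; $b=\lfloor n/2^{l-2}\rfloor$ is the value of the two most significant bits of $n$; $c_i=3$ and $d_i=\frac43$ if $\lfloor n/2^i\rfloor$ is even, while $c_i=4$ and $d_i=\frac53$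 if $\lfloor n/2^i\rfloor$ is odd; $\mathrm{popcount}(n)$ is the number of $1$ bits in the binary representation of $n$; and the sums are empty for $n=2,3$. -/

import Mathlib

namespace StatePrep

/-- The label of a computational basis state of a register with qubits `ι`: one bit per qubit. -/
abbrev Bits (ι : Type*) := ι → Fin 2

/-- The gate library: arbitrary single-qubit gates `U ∈ U(2)` on any qubit `q`, and C-NOT gates
between any two distinct qubits (control `c`, target `t`). -/
inductive Gate (ι : Type*) where
  | single (q : ι) (U : Matrix.unitaryGroup (Fin 2) ℂ) : Gate ι
  | cnot (c t : ι) (hct : c ≠ t) : Gate ι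

section
variable {ι : Type*} [Fintype ι] [DecidableEq ι]

/-- The matrix of a gate in the computational basis: `single q U` is `U` on qubit `q` tensored
with the identity on all other qubits, and `cnot c t` sends the basis state `y` to the one in which
the bit `y t` is replaced by `y t + y c` modulo 2. -/
def Gate.matrix : Gate ι → Matrix (Bits ι) (Bits ι) ℂ
  | .single q U => Matrix.of fun x y => if ∀ j, j ≠ q → x j = y j then U.1 (x q) (y q) else 0
  | .cnot c t _ => Matrix.of fun x y => if x = Function.update y t (y t + y c) then 1 else 0

end

/-- Whether a gate is a C-NOT. -/
def Gate.isCNOT {ι : Type*} : Gate ι → Bool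
  | .single _ _ => false
  | .cnot _ _ _ => true

/-- A circuit is a list of gates; the head of the list is applied first. -/
abbrev Circuit (ι : Type*) := List (Gate ι)

/-- The unitary matrix implemented by a circuit. -/
def Circuit.matrix {ι : Type*} [Fintype ι] [DecidableEq ι] :
    Circuit ι → Matrix (Bits ι) (Bits ι) ℂ
  | [] => 1
  | g :: C => Circuit.matrix C * g.matrix

/-- The number of C-NOT gates in a circuit. -/
def Circuit.cnotCount {ι : Type*} (C : Circuit ι) : ℕ := C.countP Gate.isCNOT

/-- The basis state `|0…0⟩`. -/
def zeroKet (ι : Type*) [Fintype ι] [DecidableEq ι] : Bits ι → ℂ := Pi.single 0 1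

/-- The circuit `C` maps `|0…0⟩` exactly to `ψ` (no ancillas, no global phase discarded). -/
def Circuit.Prepares {ι : Type*} [Fintype ι] [DecidableEq ι] (C : Circuit ι) (ψ : Bits ι → ℂ) :
    Prop :=
  Matrix.mulVec (Circuit.matrix C) (zeroKet ι) = ψ

/-- `ψ` is a (normalized, pure) state: its `ℓ²`-norm is `1`. -/
def IsState {ι : Type*} [Fintype ι] [DecidableEq ι] (ψ : Bits ι → ℂ) : Prop :=
  ∑ x, ‖ψ x‖ ^ 2 = 1

/-- The bit length of `n` (for `n ≥ 1`). -/
def bitLength (n : ℕ) : ℕ := Nat.log 2 n + 1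

/-- The number of `1` bits in the binary representation of `n`. -/
def popcount (n : ℕ) : ℕ := (Nat.digits 2 n).sum

/-- The value of the two most significant bits of `n` (for `n ≥ 2`). -/
def topTwoBits (n : ℕ) : ℕ := n / 2 ^ (bitLength n - 2)

/-- The coefficient `c_i`, as a function of `⌊n / 2 ^ i⌋`. -/
def cCoeff (m : ℕ) : ℚ := if Even m then 3 else 4

/-- The coefficient `d_i`, as a function of `⌊n / 2 ^ i⌋`. -/
def dCoeff (m : ℕ) : ℚ := if Even m then 4 / 3 else 5 / 3

/-- The closed form of the C-NOT count `N_state(n)`, for `n ≥ 2`. With `l = bitLength n`, the sums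
run over `0 ≤ i ≤ l - 3`, so they are empty for `n = 2, 3`. -/
def nState (n : ℕ) : ℚ :=
  11 / 12 * ∑ i ∈ Finset.range (bitLength n - 2), (2 : ℚ) ^ (n / 2 ^ i)
    - ∑ i ∈ Finset.range (bitLength n - 2), cCoeff (n / 2 ^ i) * (2 : ℚ) ^ (n / 2 ^ (i + 1))
    + ((n : ℚ) - (popcount n : ℚ) - 1)
    + ∑ i ∈ Finset.range (bitLength n - 2), dCoeff (n / 2 ^ i)
    + 1 / 2 * (topTwoBits n : ℚ) * ((topTwoBits n : ℚ) - 1)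

end StatePrep

/-!
Let a register have `k` qubits. The count rests on two recursions, one for unitaries and one for
states. Throughout, a unitary is only synthesized *up to a diagonal* on its input side, `U = W D`
with `W` a circuit and `D` a diagonal unitary; the pending diagonal is never paid for, because it
can always be pushed towards the input into something that is yet to be synthesized.

*Unitaries.* By the cosine-sine decomposition (`Matrix.exists_cosineSine`), a unitary on `k + 1`
qubits is a product of two multiplexors, selected by the top qubit, around a multiplexed rotation of
the top qubit. A multiplexor is in turn two unitaries on `k` qubits around a multiplexed
`z`-rotation (`Matrix.exists_demultiplex`, from the spectral theorem for unitary matrices).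
A multiplexed rotation costs `2 ^ k` C-NOTs, and just `2 ^ k - 1` if a final C-NOT is left over
(`BlockImpl.multRz_mul_cnotTop`). The decomposition is arranged so that the left-over C-NOTs of the
outer two rotations become `CZ` gates inside the central multiplexor. This leaves four unitaries on
`k` qubits, three multiplexed rotations, and a saving of two C-NOTs
(`blockImplUpToDiagonal_of_mem_unitaryGroup`). The recursion starts at `k = 2`, where two C-NOTs
suffice (`TwoQubit.exists_two_cnot`): in the magic basis, local gates are the special orthogonal
matrices. For `G` the matrix of `U` in this basis, the diagonal can be chosen such that `Gᵀ G` has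
determinant one and real trace, so that its eigenvalues form reciprocal pairs. Then `U` is locally
equivalent to an `XX`-`ZZ` interaction.

*States.* Split `n` qubits into halves of `⌊n / 2⌋` and `⌈n / 2⌉` qubits and write the state in
Schmidt form. The Schmidt coefficients are a state of `⌊n / 2⌋` qubits, prepared recursively; one
C-NOT for each of these qubits copies its basis states to the other half; then the two Schmidt bases
are rotated into place (`preparable_sum_self`, `preparable_sum_option`). The diagonals left over by
these rotations only change the phases of the Schmidt coefficients. If `n` is odd, the larger half
needs only an isometry that adjoins one qubit, which costs three unitaries instead of four
(`exists_blockImplUpToDiagonal_column`). The closed form `nState` satisfies the resulting recursion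
(`nState_eq_div_two`), with the initial values `1` and `3` for two and three qubits.
-/

section

open Matrix
open scoped Kronecker

/-! ### Matrix decompositions -/

theorem Matrix.diagonal_mem_unitaryGroup {n : Type*} [Fintype n] [DecidableEq n]
    {d : n → ℂ} (hd : ∀ i, ‖d i‖ = 1) : diagonal d ∈ unitaryGroup n ℂ := by
  rw [mem_unitaryGroup_iff, star_eq_conjTranspose, diagonal_conjTranspose, diagonal_mul_diagonal,
    ← diagonal_one]
  congr 1
  ext i
  rw [Pi.star_apply, Complex.star_def, Complex.mul_conj', hd]
  simp

theorem Matrix.transpose_mem_unitaryGroup {n : Type*} [Fintype n] [DecidableEq n]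
    {A : Matrix n n ℂ} (hA : A ∈ unitaryGroup n ℂ) : Aᵀ ∈ unitaryGroup n ℂ := by
  have h : Aᴴ * A = 1 := mem_unitaryGroup_iff'.1 hA
  rw [mem_unitaryGroup_iff, star_eq_conjTranspose]
  have h2 := congrArg transpose h
  rwa [transpose_mul, transpose_one] at h2

theorem Matrix.submatrix_mem_unitaryGroup {m n : Type*} [Fintype m] [DecidableEq m] [Fintype n]
    [DecidableEq n] {U : Matrix m m ℂ} (hU : U ∈ unitaryGroup m ℂ) (e : n ≃ m) :
    U.submatrix e e ∈ unitaryGroup n ℂ := by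
  have h : U * Uᴴ = 1 := mem_unitaryGroup_iff.1 hU
  rw [mem_unitaryGroup_iff, star_eq_conjTranspose, conjTranspose_submatrix, submatrix_mul_equiv, h,
    submatrix_one_equiv]

theorem Matrix.fromBlocks_diagonal_mem_unitaryGroup {n : Type*} [Fintype n] [DecidableEq n]
    {A B : Matrix n n ℂ} (hA : A ∈ unitaryGroup n ℂ) (hB : B ∈ unitaryGroup n ℂ) :
    fromBlocks A 0 0 B ∈ unitaryGroup (n ⊕ n) ℂ := by
  have hA1 : A * Aᴴ = 1 := mem_unitaryGroup_iff.1 hA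
  have hB1 : B * Bᴴ = 1 := mem_unitaryGroup_iff.1 hB
  rw [mem_unitaryGroup_iff, star_eq_conjTranspose, fromBlocks_conjTranspose, fromBlocks_multiply]
  simp [hA1, hB1]

/-- Two square matrices with the same Gram matrix differ by a unitary factor on the left
(the uniqueness part of the polar decomposition). -/
theorem Matrix.exists_unitary_mul_of_gram_eq {n : Type*} [Fintype n] [DecidableEq n]
    {M N : Matrix n n ℂ} (h : Mᴴ * M = Nᴴ * N) :
    ∃ A ∈ unitaryGroup n ℂ, M = A * N := by
  classical
  let f : EuclideanSpace ℂ n →ₗ[ℂ] EuclideanSpace ℂ n := toEuclideanLin M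
  let g : EuclideanSpace ℂ n →ₗ[ℂ] EuclideanSpace ℂ n := toEuclideanLin N
  have key : ∀ (P : Matrix n n ℂ) (x : EuclideanSpace ℂ n),
      ((‖toEuclideanLin P x‖ ^ 2 : ℝ) : ℂ) = star x.ofLp ⬝ᵥ ((Pᴴ * P) *ᵥ x.ofLp) := by
    intro P x
    have h1 := inner_self_eq_norm_sq_to_K (𝕜 := ℂ) (toEuclideanLin P x)
    rw [EuclideanSpace.inner_eq_star_dotProduct] at h1
    have h2 : (toEuclideanLin P x).ofLp = P *ᵥ x.ofLp := by simp [toLpLin_apply]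
    rw [h2] at h1
    push_cast
    have h3 : ((‖toEuclideanLin P x‖ : ℂ)) ^ 2 = P *ᵥ x.ofLp ⬝ᵥ star (P *ᵥ x.ofLp) := h1.symm
    rw [h3, dotProduct_comm, star_mulVec, ← mulVec_mulVec]
    exact (dotProduct_mulVec _ _ _).symm
  have hnorm : ∀ x, ‖f x‖ = ‖g x‖ := by
    intro x
    have h1 : ((‖f x‖ ^ 2 : ℝ) : ℂ) = ((‖g x‖ ^ 2 : ℝ) : ℂ) := by
      rw [key M x, key N x, h]
    have h2 : ‖f x‖ ^ 2 = ‖g x‖ ^ 2 := by exact_mod_cast h1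
    exact (pow_left_inj₀ (norm_nonneg _) (norm_nonneg _) two_ne_zero).1 h2
  obtain ⟨s, hs⟩ := g.rangeRestrict.exists_rightInverse_of_surjective g.range_rangeRestrict
  have hs' : ∀ y, g (s y) = y := fun y => by
    have := congrArg Subtype.val (LinearMap.congr_fun hs y)
    simpa using! this
  let L : g.range →ₗᵢ[ℂ] EuclideanSpace ℂ n :=
    { toLinearMap := f ∘ₗ s
      norm_map' := fun y => by
        change ‖f (s y)‖ = ‖y‖
        rw [hnorm, hs', Submodule.coe_norm] }
  have hL : ∀ x, L.extend (g x) = f x := by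
    intro x
    have h1 := L.extend_apply ⟨g x, x, rfl⟩
    change L.extend (g x) = f (s ⟨g x, x, rfl⟩) at h1
    rw [h1, ← sub_eq_zero, ← map_sub, ← norm_eq_zero, hnorm, map_sub, hs', norm_eq_zero, sub_self]
  refine ⟨toEuclideanLin.symm L.extend.toLinearMap, ?_, ?_⟩
  · rw [mem_unitaryGroup_iff', star_eq_conjTranspose]
    ext i j
    have h1 := L.extend.inner_map_map (EuclideanSpace.single i (1 : ℂ)) (EuclideanSpace.single j 1)
    set A := toEuclideanLin.symm L.extend.toLinearMap with hA
    have h2 : ∀ x, L.extend x = toEuclideanLin A x := fun x => by simp [hA]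
    rw [h2, h2, EuclideanSpace.inner_eq_star_dotProduct, EuclideanSpace.inner_eq_star_dotProduct,
      dotProduct_comm] at h1
    simp [toLpLin_apply, dotProduct, Pi.single_apply] at h1
    rw [mul_apply, one_apply]
    simpa [conjTranspose_apply, eq_comm] using h1
  · apply toEuclideanLin.injective
    ext1 x
    have h2 : ∀ (P Q : Matrix n n ℂ) x, toEuclideanLin (P * Q) x
        = toEuclideanLin P (toEuclideanLin Q x) := by
      intro P Q x; simp [toLpLin_apply, mulVec_mulVec]
    rw [h2]
    simpa using (hL x).symm

/-- Cayley transform: away from a suitable phase `ω` that is not an eigenvalue, a unitary matrix is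
a Möbius transform of a Hermitian matrix, which is symmetric if the unitary is. -/
theorem Matrix.exists_cayley {n : Type*} [Fintype n] [DecidableEq n]
    {S : Matrix n n ℂ} (hS : S ∈ unitaryGroup n ℂ) :
    ∃ (ω : ℂ) (H : Matrix n n ℂ), ‖ω‖ = 1 ∧ H.IsHermitian ∧ (Sᵀ = S → Hᵀ = H) ∧
      (H + Complex.I • 1) * S = ω • (H - Complex.I • 1) := by
  obtain ⟨ω, hω, hdet⟩ : ∃ ω : ℂ, ‖ω‖ = 1 ∧ S.charpoly.eval ω ≠ 0 := by
    have hinf : (Metric.sphere (0 : ℂ) 1).Infinite := by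
      refine (Set.infinite_range_of_injective
        (f := fun k : ℕ => Complex.exp ((1 / (k + 1 : ℝ) : ℝ) * Complex.I)) ?_).mono ?_
      · intro a b hab
        have h1 := congrArg Complex.arg hab
        have hr : ∀ k : ℕ, (1 / (k + 1 : ℝ) : ℝ) ∈ Set.Ioc (-Real.pi) Real.pi := by
          intro k
          have h0 : (0 : ℝ) < 1 / (k + 1 : ℝ) := by positivity
          have h1 : 1 / (k + 1 : ℝ) ≤ 1 := by
            rw [div_le_one (by positivity)]
            have : (0 : ℝ) ≤ k := k.cast_nonneg
            linarith
          constructor <;> linarith [Real.pi_gt_three]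
        simp only [Complex.arg_exp_mul_I] at h1
        rw [(toIocMod_eq_self Real.two_pi_pos).2 (by simpa [two_mul] using hr a),
          (toIocMod_eq_self Real.two_pi_pos).2 (by simpa [two_mul] using hr b)] at h1
        have : (a : ℝ) + 1 = b + 1 := by simpa using h1
        exact_mod_cast add_right_cancel this
      · rintro _ ⟨k, rfl⟩
        simp only [mem_sphere_zero_iff_norm]
        exact Complex.norm_exp_ofReal_mul_I _
    obtain ⟨ω, h1, h2⟩ := hinf.exists_notMem_finset S.charpoly.roots.toFinset
    refine ⟨ω, by simpa using h1, fun h => h2 ?_⟩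
    rw [Multiset.mem_toFinset, Polynomial.mem_roots (charpoly_monic S).ne_zero]
    exact h
  have hωω : ω * star ω = 1 := by
    rw [Complex.star_def, Complex.mul_conj', hω]; simp
  obtain ⟨T, hST, hT⟩ : ∃ T : Matrix n n ℂ, S = ω • T ∧ T = star ω • S :=
    ⟨star ω • S, by rw [smul_smul, hωω, one_smul], rfl⟩
  have hT1 : Tᴴ * T = 1 := by
    have hS1 : Sᴴ * S = 1 := mem_unitaryGroup_iff'.1 hS
    rw [hT, conjTranspose_smul, star_star, Matrix.smul_mul, Matrix.mul_smul, smul_smul, hωω,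
      one_smul, hS1]
  set P : Matrix n n ℂ := 1 - T with hP
  have hPu : IsUnit P.det := by
    rw [isUnit_iff_ne_zero]
    intro h0
    apply hdet
    have h1 : (scalar n) ω - S = ω • P := by
      rw [hP, smul_sub, ← hST]
      congr 1
      ext i j
      simp [one_apply, diagonal_apply]
    rw [eval_charpoly, h1, det_smul, h0, mul_zero]
  have hP1 : P * P⁻¹ = 1 := mul_nonsing_inv _ hPu
  have hP2 : P⁻¹ * P = 1 := nonsing_inv_mul _ hPu
  have hPHu : IsUnit Pᴴ.det := by
    rw [det_conjTranspose]; exact hPu.star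
  set H : Matrix n n ℂ := Complex.I • ((1 + T) * P⁻¹) with hH
  have hHP : H * P = Complex.I • (1 + T) := by
    rw [hH, Matrix.smul_mul, Matrix.mul_assoc, hP2, Matrix.mul_one]
  refine ⟨ω, H, hω, ?_, fun hsym => ?_, ?_⟩
  · change Hᴴ = H
    -- it suffices to compare `H` and its adjoint as sesquilinear forms on the range of `P`
    have h1 : Pᴴ * (Hᴴ * P) = Pᴴ * (H * P) := by
      rw [← Matrix.mul_assoc, ← conjTranspose_mul, hHP]
      simp only [hP, conjTranspose_smul, conjTranspose_add, conjTranspose_one, conjTranspose_sub,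
        Complex.star_def, Complex.conj_I, Matrix.mul_smul, Matrix.smul_mul, Matrix.mul_sub,
        Matrix.add_mul, Matrix.sub_mul, Matrix.mul_add, Matrix.one_mul, Matrix.mul_one, hT1]
      module
    have h2 : Hᴴ * P = H * P := by
      have := congrArg (fun X => (Pᴴ)⁻¹ * X) h1
      simpa only [← Matrix.mul_assoc, nonsing_inv_mul _ hPHu, Matrix.one_mul] using this
    have := congrArg (fun X => X * P⁻¹) h2
    simpa only [Matrix.mul_assoc, hP1, Matrix.mul_one] using this
  · have hTT : Tᵀ = T := by rw [hT, transpose_smul, hsym]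
    have hcomm : (1 + T) * P = P * (1 + T) := by
      simp only [hP, Matrix.mul_sub, Matrix.add_mul, Matrix.sub_mul, Matrix.mul_add,
        Matrix.one_mul, Matrix.mul_one]
      abel
    rw [hH, transpose_smul, transpose_mul, transpose_nonsing_inv, transpose_add, transpose_one, hTT,
      show Pᵀ = P by rw [hP, transpose_sub, transpose_one, hTT]]
    congr 1
    calc P⁻¹ * (1 + T) = P⁻¹ * ((1 + T) * P) * P⁻¹ := by
          rw [Matrix.mul_assoc, Matrix.mul_assoc, hP1, Matrix.mul_one]
      _ = (1 + T) * P⁻¹ := by rw [hcomm, ← Matrix.mul_assoc, hP2, Matrix.one_mul]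
  · have h2 : H * T = H - Complex.I • (1 + T) := by
      rw [← hHP, hP, Matrix.mul_sub, Matrix.mul_one, sub_sub_cancel]
    rw [hST, Matrix.mul_smul, Matrix.add_mul, h2]
    congr 1
    simp only [Matrix.smul_mul, Matrix.one_mul]
    module

/-- If `V` diagonalizes the Hermitian Cayley transform `H` of `S`, then it diagonalizes `S`. -/
theorem Matrix.eq_conj_diagonal_of_cayley {n : Type*} [Fintype n] [DecidableEq n]
    {S H V : Matrix n n ℂ} {ω : ℂ} (hV : V ∈ unitaryGroup n ℂ) {μ : n → ℝ}
    (hH : H = V * diagonal (fun i => (μ i : ℂ)) * Vᴴ)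
    (h : (H + Complex.I • 1) * S = ω • (H - Complex.I • 1)) :
    S = V * diagonal (fun i => ω * ((μ i - Complex.I) / (μ i + Complex.I))) * Vᴴ := by
  have hV1 : Vᴴ * V = 1 := mem_unitaryGroup_iff'.1 hV
  have hV2 : V * Vᴴ = 1 := mem_unitaryGroup_iff.1 hV
  have e : ∀ c : ℂ, H + c • 1 = V * diagonal (fun i => (μ i : ℂ) + c) * Vᴴ := by
    intro c
    have : (diagonal fun i => (μ i : ℂ) + c) = diagonal (fun i => (μ i : ℂ)) + c • 1 := by
      rw [smul_one_eq_diagonal, diagonal_add]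
    rw [this, Matrix.mul_add, Matrix.add_mul, ← hH]
    simp [hV2]
  have e' : H - Complex.I • 1 = V * diagonal (fun i => (μ i : ℂ) - Complex.I) * Vᴴ := by
    simpa [sub_eq_add_neg] using e (-Complex.I)
  have hne : ∀ i, (μ i : ℂ) + Complex.I ≠ 0 := fun i h0 => by
    simpa using congrArg Complex.im h0
  rw [e, e'] at h
  set a : n → ℂ := fun i => (μ i : ℂ) + Complex.I with ha
  have hinv : V * diagonal (fun i => (a i)⁻¹) * Vᴴ * (V * diagonal a * Vᴴ) = 1 := by
    calc _ = V * (diagonal (fun i => (a i)⁻¹) * (Vᴴ * V) * diagonal a) * Vᴴ := by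
          simp only [Matrix.mul_assoc]
      _ = 1 := by
          rw [hV1, Matrix.mul_one, diagonal_mul_diagonal]
          simp [ha, hne, hV2]
  calc S = V * diagonal (fun i => (a i)⁻¹) * Vᴴ * (V * diagonal a * Vᴴ * S) := by
        rw [← Matrix.mul_assoc, hinv, Matrix.one_mul]
    _ = ω • (V * (diagonal (fun i => (a i)⁻¹) * (Vᴴ * V)
          * diagonal (fun i => (μ i : ℂ) - Complex.I)) * Vᴴ) := by
        rw [h]; simp only [Matrix.mul_assoc, Matrix.mul_smul]
    _ = _ := by
        rw [hV1, Matrix.mul_one, diagonal_mul_diagonal, ← Matrix.smul_mul, ← Matrix.mul_smul,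
          ← diagonal_smul]
        congr 3
        ext i
        simp [ha, div_eq_mul_inv, mul_comm]

theorem norm_cayley (ω : ℂ) (hω : ‖ω‖ = 1) (μ : ℝ) :
    ‖ω * ((μ - Complex.I) / (μ + Complex.I))‖ = 1 := by
  have h : (μ : ℂ) - Complex.I = (starRingEnd ℂ) (μ + Complex.I) := by simp [sub_eq_add_neg]
  have hne : (μ : ℂ) + Complex.I ≠ 0 := fun h0 => by
    simpa using congrArg Complex.im h0
  rw [norm_mul, norm_div, hω, h, Complex.norm_conj, div_self (norm_ne_zero_iff.2 hne), one_mul]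

/-- Spectral theorem for unitary matrices. -/
theorem Matrix.exists_unitary_diagonalization {n : Type*} [Fintype n] [DecidableEq n]
    {S : Matrix n n ℂ} (hS : S ∈ unitaryGroup n ℂ) :
    ∃ V ∈ unitaryGroup n ℂ, ∃ d : n → ℂ, (∀ i, ‖d i‖ = 1) ∧ S = V * diagonal d * Vᴴ := by
  obtain ⟨ω, H, hω, hH, -, h⟩ := exists_cayley hS
  refine ⟨hH.eigenvectorUnitary, hH.eigenvectorUnitary.2, _, fun i => ?_,
    eq_conj_diagonal_of_cayley hH.eigenvectorUnitary.2 (μ := hH.eigenvalues) ?_ h⟩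
  · exact norm_cayley _ hω _
  · conv_lhs => rw [hH.spectral_theorem]
    rw [Unitary.conjStarAlgAut_apply]
    rfl

/-- A symmetric unitary matrix is diagonalized by a real orthogonal matrix. -/
theorem Matrix.exists_orthogonal_diagonalization {n : Type*} [Fintype n] [DecidableEq n]
    {S : Matrix n n ℂ} (hS : S ∈ unitaryGroup n ℂ) (hsym : Sᵀ = S) :
    ∃ V ∈ unitaryGroup n ℂ, Vᵀ = Vᴴ ∧ ∃ d : n → ℂ, (∀ i, ‖d i‖ = 1) ∧
      S = V * diagonal d * Vᵀ := by
  obtain ⟨ω, H, hω, hH, hHsym, h⟩ := exists_cayley hS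
  have hreal : ∀ i j, ((H i j).re : ℂ) = H i j := by
    intro i j
    have h1 : star (H j i) = H i j := congrFun (congrFun hH i) j
    have h2 : H j i = H i j := congrFun (congrFun (hHsym hsym) i) j
    rw [h2] at h1
    exact Complex.conj_eq_iff_re.1 h1
  let K : Matrix n n ℝ := of fun i j => (H i j).re
  have hK : K.IsHermitian := by
    ext i j
    have h2 : H j i = H i j := congrFun (congrFun (hHsym hsym) i) j
    simp [K, h2]
  let O : Matrix n n ℝ := hK.eigenvectorUnitary
  have hO : Oᵀ * O = 1 := by
    have := mem_unitaryGroup_iff'.1 hK.eigenvectorUnitary.2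
    rwa [star_eq_conjTranspose, conjTranspose_eq_transpose_of_trivial] at this
  let V : Matrix n n ℂ := O.map Complex.ofRealHom
  have hVT : Vᵀ = Vᴴ := by
    ext i j
    simp [V, conjTranspose_apply]
  have hV : V ∈ unitaryGroup n ℂ := by
    rw [mem_unitaryGroup_iff', star_eq_conjTranspose, ← hVT,
      show Vᵀ = Oᵀ.map Complex.ofRealHom from rfl, ← Matrix.map_mul, hO]
    simp
  have hHV : H = V * diagonal (fun i => (hK.eigenvalues i : ℂ)) * Vᴴ := by
    have h1 : K = O * diagonal hK.eigenvalues * Oᵀ := by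
      conv_lhs => rw [hK.spectral_theorem]
      rw [Unitary.conjStarAlgAut_apply]
      rfl
    have h2 : H = K.map Complex.ofRealHom := by
      ext i j; simp [K, hreal]
    have h3 := congrArg (fun X : Matrix n n ℝ => X.map Complex.ofRealHom) h1
    simp only [Matrix.map_mul] at h3
    rw [← h2, diagonal_map (by simp)] at h3
    rw [← hVT]
    exact h3
  exact ⟨V, hV, hVT, _, fun i => norm_cayley _ hω _, by
    rw [hVT]; exact eq_conj_diagonal_of_cayley hV hHV h⟩

/-- Demultiplexing: a pair of unitaries selected by a qubit is a common unitary, followed by a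
diagonal selected between `D` and `D†`, followed by a common unitary. -/
theorem Matrix.exists_demultiplex {n : Type*} [Fintype n] [DecidableEq n]
    {A B : Matrix n n ℂ} (hA : A ∈ unitaryGroup n ℂ) (hB : B ∈ unitaryGroup n ℂ) :
    ∃ V ∈ unitaryGroup n ℂ, ∃ W ∈ unitaryGroup n ℂ, ∃ θ : n → ℝ,
      A = V * diagonal (fun i => Complex.exp (θ i * Complex.I)) * W ∧
      B = V * diagonal (fun i => Complex.exp (-(θ i) * Complex.I)) * W := by
  obtain ⟨V, hV, d, hd, h⟩ := exists_unitary_diagonalization (mul_mem hA (Unitary.star_mem hB))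
  have hV2 : V * Vᴴ = 1 := mem_unitaryGroup_iff.1 hV
  have hV1 : Vᴴ * V = 1 := mem_unitaryGroup_iff'.1 hV
  have hB1 : Bᴴ * B = 1 := mem_unitaryGroup_iff'.1 hB
  let θ : n → ℝ := fun i => (d i).arg / 2
  have hθ : ∀ i, d i = Complex.exp (θ i * Complex.I) * Complex.exp (θ i * Complex.I) := by
    intro i
    rw [← Complex.exp_add]
    have h1 := Complex.norm_mul_exp_arg_mul_I (d i)
    rw [hd, Complex.ofReal_one, one_mul] at h1
    conv_lhs => rw [← h1]
    congr 1
    simp only [θ]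
    push_cast
    ring
  have hE : (diagonal fun i => Complex.exp (θ i * Complex.I)) *
      (diagonal fun i => Complex.exp (-(θ i) * Complex.I)) = 1 := by
    rw [diagonal_mul_diagonal]
    simp [← Complex.exp_add]
  have hd2 : diagonal d = (diagonal fun i => Complex.exp (θ i * Complex.I)) *
      (diagonal fun i => Complex.exp (θ i * Complex.I)) := by
    rw [diagonal_mul_diagonal]
    congr 1
    ext i
    exact hθ i
  set E := diagonal fun i => Complex.exp (θ i * Complex.I)
  set E' := diagonal fun i => Complex.exp (-(θ i) * Complex.I)
  have hEH : Eᴴ = E' := by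
    rw [diagonal_conjTranspose]
    congr 1
    ext i
    simp [← Complex.exp_conj]
  have hE' : E' * E = 1 := mul_eq_one_comm.1 hE
  refine ⟨V, hV, E * Vᴴ * B, mul_mem (mul_mem ?_ (Unitary.star_mem hV)) hB, θ, ?_, ?_⟩
  · rw [mem_unitaryGroup_iff, star_eq_conjTranspose, hEH, hE]
  · have h1 : A = A * Bᴴ * B := by rw [Matrix.mul_assoc, hB1, Matrix.mul_one]
    rw [h1, show A * Bᴴ = V * diagonal d * Vᴴ from h, hd2]
    simp only [Matrix.mul_assoc]
    rfl
  · calc B = V * (E' * E) * Vᴴ * B := by rw [hE', Matrix.mul_one, hV2, Matrix.one_mul]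
      _ = _ := by simp only [Matrix.mul_assoc]; rfl

open scoped ComplexOrder in
/-- The Gram matrix `PᴴP` as `NᴴN` with `N = diag(s) R`. -/
theorem Matrix.exists_gram_diagonalization {m n : Type*} [Fintype m] [Fintype n] [DecidableEq n]
    (P : Matrix m n ℂ) :
    ∃ R ∈ unitaryGroup n ℂ, ∃ s : n → ℝ, (∀ i, 0 ≤ s i) ∧
      Pᴴ * P = Rᴴ * diagonal (fun i => ((s i ^ 2 : ℝ) : ℂ)) * R := by
  have hpos := posSemidef_conjTranspose_mul_self P
  have hH := hpos.isHermitian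
  refine ⟨star hH.eigenvectorUnitary.1, Unitary.star_mem hH.eigenvectorUnitary.2,
    fun i => √(hH.eigenvalues i), fun i => Real.sqrt_nonneg _, ?_⟩
  have h1 : ∀ i, √(hH.eigenvalues i) ^ 2 = hH.eigenvalues i := fun i =>
    Real.sq_sqrt (hpos.eigenvalues_nonneg i)
  simp only [h1]
  conv_lhs => rw [hH.spectral_theorem]
  rw [Unitary.conjStarAlgAut_apply, ← star_eq_conjTranspose, star_star]
  rfl

theorem Matrix.diagonal_conjTranspose_mul_self {n : Type*} [Fintype n] [DecidableEq n]
    (s : n → ℝ) (R : Matrix n n ℂ) :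
    (diagonal (fun i => (s i : ℂ)) * R)ᴴ * (diagonal (fun i => (s i : ℂ)) * R)
      = Rᴴ * diagonal (fun i => ((s i ^ 2 : ℝ) : ℂ)) * R := by
  rw [conjTranspose_mul, diagonal_conjTranspose,
    show ∀ D D' : Matrix n n ℂ, Rᴴ * D * (D' * R) = Rᴴ * (D * D') * R by
      intro D D'; simp only [Matrix.mul_assoc], diagonal_mul_diagonal]
  congr 3
  ext i
  simp [sq]

/-- The squared norm of a matrix in terms of its singular values. -/
theorem Matrix.sum_sq_eq_of_gram {m n : Type*} [Fintype m] [Fintype n] [DecidableEq n]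
    {P : Matrix m n ℂ} {R : Matrix n n ℂ} (hR : R ∈ unitaryGroup n ℂ) {s : n → ℝ}
    (h : Pᴴ * P = Rᴴ * diagonal (fun i => ((s i ^ 2 : ℝ) : ℂ)) * R) :
    ∑ i, s i ^ 2 = ∑ x, ∑ y, ‖P x y‖ ^ 2 := by
  have hR2 : R * Rᴴ = 1 := mem_unitaryGroup_iff.1 hR
  have h1 := congrArg trace h
  rw [trace_mul_comm (Rᴴ * _), ← Matrix.mul_assoc, hR2, Matrix.one_mul, trace_diagonal] at h1
  rw [Finset.sum_comm]
  simp only [trace, diag_apply, mul_apply, conjTranspose_apply, Complex.star_def,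
    Complex.conj_mul'] at h1
  exact_mod_cast h1.symm

open scoped ComplexOrder in
/-- Cosine-sine decomposition of the first block column of a unitary matrix. -/
theorem Matrix.exists_cosineSine_column {n : Type*} [Fintype n] [DecidableEq n]
    {X Z : Matrix n n ℂ} (h : Xᴴ * X + Zᴴ * Z = 1) :
    ∃ L₀ ∈ unitaryGroup n ℂ, ∃ L₁ ∈ unitaryGroup n ℂ, ∃ R ∈ unitaryGroup n ℂ, ∃ θ : n → ℝ,
      X = L₀ * diagonal (fun i => (Real.cos (θ i) : ℂ)) * R ∧
      Z = L₁ * diagonal (fun i => (Real.sin (θ i) : ℂ)) * R := by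
  obtain ⟨R, hR, s, hs, hX⟩ := exists_gram_diagonalization X
  have hR2 : R * Rᴴ = 1 := mem_unitaryGroup_iff.1 hR
  have hR1 : Rᴴ * R = 1 := mem_unitaryGroup_iff'.1 hR
  have hZ : Zᴴ * Z = Rᴴ * diagonal (fun i => ((1 - s i ^ 2 : ℝ) : ℂ)) * R := by
    have h1 : diagonal (fun i => ((1 - s i ^ 2 : ℝ) : ℂ))
        = 1 - diagonal (fun i => ((s i ^ 2 : ℝ) : ℂ)) := by
      rw [← diagonal_one, diagonal_sub]
      simp
    rw [h1, Matrix.mul_sub, Matrix.sub_mul, Matrix.mul_one, hR1, ← hX, ← h, add_sub_cancel_left]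
  have hle : ∀ i, 0 ≤ 1 - s i ^ 2 := by
    intro i
    have h1 : (Z * Rᴴ)ᴴ * (Z * Rᴴ) = diagonal (fun i => ((1 - s i ^ 2 : ℝ) : ℂ)) := by
      rw [conjTranspose_mul, conjTranspose_conjTranspose,
        show R * Zᴴ * (Z * Rᴴ) = R * (Zᴴ * Z) * Rᴴ by simp only [Matrix.mul_assoc], hZ]
      rw [show R * (Rᴴ * diagonal (fun i => ((1 - s i ^ 2 : ℝ) : ℂ)) * R) * Rᴴ
        = (R * Rᴴ) * diagonal (fun i => ((1 - s i ^ 2 : ℝ) : ℂ)) * (R * Rᴴ) by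
          simp only [Matrix.mul_assoc], hR2, Matrix.one_mul, Matrix.mul_one]
    have h2 := (posSemidef_conjTranspose_mul_self (Z * Rᴴ)).diag_nonneg (i := i)
    rw [h1, diagonal_apply_eq] at h2
    exact_mod_cast h2
  have hcos : ∀ i, Real.cos (Real.arccos (s i)) = s i := fun i =>
    Real.cos_arccos (by linarith [hs i]) (by nlinarith [hle i, hs i])
  obtain ⟨L₀, hL₀, e₀⟩ := exists_unitary_mul_of_gram_eq (M := X)
    (N := diagonal (fun i => (Real.cos (Real.arccos (s i)) : ℂ)) * R) (by
      rw [diagonal_conjTranspose_mul_self (fun i => Real.cos (Real.arccos (s i))), hX]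
      simp only [hcos])
  obtain ⟨L₁, hL₁, e₁⟩ := exists_unitary_mul_of_gram_eq (M := Z)
    (N := diagonal (fun i => (Real.sin (Real.arccos (s i)) : ℂ)) * R) (by
      rw [diagonal_conjTranspose_mul_self (fun i => Real.sin (Real.arccos (s i))), hZ]
      simp only [Real.sin_sq, hcos])
  exact ⟨L₀, hL₀, L₁, hL₁, R, hR, fun i => Real.arccos (s i), by rw [e₀, Matrix.mul_assoc],
    by rw [e₁, Matrix.mul_assoc]⟩

/-- Cosine-sine decomposition of a unitary matrix. -/
theorem Matrix.exists_cosineSine {n : Type*} [Fintype n] [DecidableEq n]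
    {U : Matrix (n ⊕ n) (n ⊕ n) ℂ} (hU : U ∈ unitaryGroup (n ⊕ n) ℂ) :
    ∃ L₀ ∈ unitaryGroup n ℂ, ∃ L₁ ∈ unitaryGroup n ℂ, ∃ R₀ ∈ unitaryGroup n ℂ,
      ∃ R₁ ∈ unitaryGroup n ℂ, ∃ θ : n → ℝ,
      U = fromBlocks L₀ 0 0 L₁ *
        fromBlocks (diagonal fun i => (Real.cos (θ i) : ℂ))
          (diagonal fun i => -(Real.sin (θ i) : ℂ))
          (diagonal fun i => (Real.sin (θ i) : ℂ)) (diagonal fun i => (Real.cos (θ i) : ℂ)) *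
        fromBlocks R₀ 0 0 R₁ := by
  obtain ⟨X, Y, Z, W, rfl⟩ : ∃ X Y Z W, U = fromBlocks X Y Z W :=
    ⟨_, _, _, _, (fromBlocks_toBlocks U).symm⟩
  have h1 : Xᴴ * X + Zᴴ * Z = 1 := by
    have h := mem_unitaryGroup_iff'.1 hU
    rw [star_eq_conjTranspose, fromBlocks_conjTranspose, fromBlocks_multiply, ← fromBlocks_one,
      fromBlocks_inj] at h
    exact h.1
  obtain ⟨L₀, hL₀, L₁, hL₁, R, hR, θ, hX, hZ⟩ := exists_cosineSine_column h1
  set C := diagonal fun i => (Real.cos (θ i) : ℂ) with hC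
  set S := diagonal fun i => (Real.sin (θ i) : ℂ) with hS
  have hS' : (diagonal fun i => -(Real.sin (θ i) : ℂ)) = -S := (diagonal_neg _).symm
  have hCC : Cᴴ = C := by
    rw [hC, diagonal_conjTranspose]; congr 1; ext i; exact Complex.conj_ofReal _
  have hSS : Sᴴ = S := by
    rw [hS, diagonal_conjTranspose]; congr 1; ext i; exact Complex.conj_ofReal _
  have hcomm : C * S = S * C := by
    rw [hC, hS, diagonal_mul_diagonal, diagonal_mul_diagonal]; simp [mul_comm]
  have hone : C * C + S * S = 1 := by
    rw [hC, hS, diagonal_mul_diagonal, diagonal_mul_diagonal, diagonal_add, ← diagonal_one]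
    congr 1
    ext i
    have := Real.cos_sq_add_sin_sq (θ i)
    simp only [← sq]
    exact_mod_cast this
  have hL₀1 : L₀ᴴ * L₀ = 1 := mem_unitaryGroup_iff'.1 hL₀
  have hL₁1 : L₁ᴴ * L₁ = 1 := mem_unitaryGroup_iff'.1 hL₁
  have hR1 : R * Rᴴ = 1 := mem_unitaryGroup_iff.1 hR
  set K := fromBlocks C (-S) S C with hK
  have hKu : K ∈ unitaryGroup (n ⊕ n) ℂ := by
    rw [mem_unitaryGroup_iff, star_eq_conjTranspose, hK, fromBlocks_conjTranspose,
      fromBlocks_multiply]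
    simp [hCC, hSS, hone, hcomm, add_comm (S * S)]
  have hLu := fromBlocks_diagonal_mem_unitaryGroup hL₀ hL₁
  have hQ : fromBlocks X Y Z W * fromBlocks Rᴴ 0 0 1
      = fromBlocks L₀ 0 0 L₁ * fromBlocks C (L₀ᴴ * Y) S (L₁ᴴ * W) := by
    have hL₀2 : L₀ * L₀ᴴ = 1 := mem_unitaryGroup_iff.1 hL₀
    have hL₁2 : L₁ * L₁ᴴ = 1 := mem_unitaryGroup_iff.1 hL₁
    simp only [fromBlocks_multiply, hX, hZ, Matrix.mul_assoc, hR1]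
    simp [← Matrix.mul_assoc, hL₀2, hL₁2]
  -- after removing the known factors the first block column is `(1, 0)`, so unitarity forces the
  -- remaining matrix to be block diagonal
  obtain ⟨Y', W', hM⟩ : ∃ Y' W' : Matrix n n ℂ,
      Kᴴ * fromBlocks C (L₀ᴴ * Y) S (L₁ᴴ * W) = fromBlocks 1 Y' 0 W' := by
    refine ⟨C * (L₀ᴴ * Y) + S * (L₁ᴴ * W), -S * (L₀ᴴ * Y) + C * (L₁ᴴ * W), ?_⟩
    rw [hK, fromBlocks_conjTranspose, fromBlocks_multiply]
    simp only [conjTranspose_neg, hCC, hSS, hone, Matrix.neg_mul, hcomm, neg_add_cancel]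
  have hMu : fromBlocks 1 Y' 0 W' ∈ unitaryGroup (n ⊕ n) ℂ := by
    have e : fromBlocks 1 Y' 0 W' = star K * (star (fromBlocks L₀ 0 0 L₁) *
        (fromBlocks X Y Z W * fromBlocks Rᴴ 0 0 1)) := by
      rw [hQ, ← Matrix.mul_assoc (star (fromBlocks L₀ 0 0 L₁)), mem_unitaryGroup_iff'.1 hLu,
        Matrix.one_mul]
      exact hM.symm
    rw [e]
    exact mul_mem (Unitary.star_mem hKu) (mul_mem (Unitary.star_mem hLu)
      (mul_mem hU (fromBlocks_diagonal_mem_unitaryGroup (Unitary.star_mem hR) (one_mem _))))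
  have hY'W' : Y' = 0 ∧ W' ∈ unitaryGroup n ℂ := by
    have h := mem_unitaryGroup_iff'.1 hMu
    rw [star_eq_conjTranspose, fromBlocks_conjTranspose, fromBlocks_multiply, ← fromBlocks_one,
      fromBlocks_inj] at h
    obtain ⟨-, h2, -, h4⟩ := h
    have hY : Y' = 0 := by simpa using h2
    exact ⟨hY, mem_unitaryGroup_iff'.2 (by simpa [hY, star_eq_conjTranspose] using h4)⟩
  refine ⟨L₀, hL₀, L₁, hL₁, R, hR, W', hY'W'.2, θ, ?_⟩
  rw [hS']
  have hKK : K * Kᴴ = 1 := mem_unitaryGroup_iff.1 hKu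
  have hR' : fromBlocks (Rᴴ) 0 0 (1 : Matrix n n ℂ) * fromBlocks R 0 0 1 = 1 := by
    rw [fromBlocks_multiply]
    have : Rᴴ * R = 1 := mem_unitaryGroup_iff'.1 hR
    simp [this]
  calc fromBlocks X Y Z W = fromBlocks X Y Z W * fromBlocks Rᴴ 0 0 1 * fromBlocks R 0 0 1 := by
        rw [Matrix.mul_assoc, hR', Matrix.mul_one]
    _ = fromBlocks L₀ 0 0 L₁ * (K * (Kᴴ * fromBlocks C (L₀ᴴ * Y) S (L₁ᴴ * W)))
          * fromBlocks R 0 0 1 := by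
        rw [hQ, ← Matrix.mul_assoc K, hKK, Matrix.one_mul]
    _ = fromBlocks L₀ 0 0 L₁ * K * (fromBlocks 1 Y' 0 W' * fromBlocks R 0 0 1) := by
        rw [hM]; simp only [Matrix.mul_assoc]
    _ = fromBlocks L₀ 0 0 L₁ * K * fromBlocks R 0 0 W' := by
        rw [hY'W'.1, fromBlocks_multiply (1 : Matrix n n ℂ)]; simp

/-! ### Two-qubit unitaries up to a diagonal -/

namespace TwoQubit

/-- The alternating form on `ℂ²`. -/
def symplectic : Matrix (Fin 2) (Fin 2) ℂ := !![0, 1; -1, 0]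

/-- The symmetric bilinear form on `ℂ² ⊗ ℂ²` whose quadratic form is `2 det`; it vanishes exactly
on the product vectors. -/
def detForm : Matrix (Fin 2 × Fin 2) (Fin 2 × Fin 2) ℂ := symplectic ⊗ₖ symplectic

/-- The C-NOT matrix with the first qubit as control. -/
def cnotMatrix : Matrix (Fin 2 × Fin 2) (Fin 2 × Fin 2) ℂ :=
  of fun x y => if x = (y.1, y.2 + y.1) then 1 else 0

/-- The Hadamard matrix. -/
noncomputable def hadamard : Matrix (Fin 2) (Fin 2) ℂ :=
  (1 / (√2 : ℝ) : ℂ) • !![1, 1; 1, -1]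

theorem sqrt_two_inv_mul_self : (1 / (√2 : ℝ) : ℂ) * (1 / (√2 : ℝ) : ℂ) = 1 / 2 := by
  rw [div_mul_div_comm, ← Complex.ofReal_mul, Real.mul_self_sqrt (by norm_num)]
  norm_num

theorem hadamard_mul_hadamard : hadamard * hadamard = 1 := by
  rw [hadamard, Matrix.smul_mul, Matrix.mul_smul, smul_smul, sqrt_two_inv_mul_self]
  ext i j
  fin_cases i <;> fin_cases j <;> norm_num [mul_apply, Fin.sum_univ_two, one_apply]

theorem hadamard_conjTranspose : hadamardᴴ = hadamard := by
  rw [hadamard, conjTranspose_smul]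
  congr 1
  · simp
  · ext i j
    fin_cases i <;> fin_cases j <;> simp

theorem hadamard_mem : hadamard ∈ unitaryGroup (Fin 2) ℂ := by
  rw [mem_unitaryGroup_iff, star_eq_conjTranspose, hadamard_conjTranspose, hadamard_mul_hadamard]

theorem transpose_mul_symplectic_mul (a : Matrix (Fin 2) (Fin 2) ℂ) :
    aᵀ * symplectic * a = a.det • symplectic := by
  ext i j
  fin_cases i <;> fin_cases j <;>
    simp [symplectic, mul_apply, Fin.sum_univ_two, det_fin_two] <;> ring

theorem kronecker_transpose_mul_detForm_mul (a b : Matrix (Fin 2) (Fin 2) ℂ) :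
    (a ⊗ₖ b)ᵀ * detForm * (a ⊗ₖ b) = (a.det * b.det) • detForm := by
  rw [← kroneckerMap_transpose, detForm, ← mul_kronecker_mul, ← mul_kronecker_mul,
    transpose_mul_symplectic_mul, transpose_mul_symplectic_mul, smul_kronecker, kronecker_smul,
    smul_smul]

theorem transpose_mul_detForm_mul_apply (W : Matrix (Fin 2 × Fin 2) (Fin 2 × Fin 2) ℂ)
    (x y : Fin 2 × Fin 2) :
    (Wᵀ * detForm * W) x y = W (0, 0) x * W (1, 1) y - W (0, 1) x * W (1, 0) y
      - W (1, 0) x * W (0, 1) y + W (1, 1) x * W (0, 0) y := by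
  simp [detForm, symplectic, mul_apply, Fintype.sum_prod_type, Fin.sum_univ_two,
    kroneckerMap_apply]
  ring

theorem kronecker_mem {a b : Matrix (Fin 2) (Fin 2) ℂ} (ha : a ∈ unitaryGroup (Fin 2) ℂ)
    (hb : b ∈ unitaryGroup (Fin 2) ℂ) : a ⊗ₖ b ∈ unitaryGroup (Fin 2 × Fin 2) ℂ :=
  kronecker_mem_unitary ha hb

/-- A unit vector of `ℂ²` is the first column of a matrix in `SU(2)`. -/
theorem exists_special_unitary_column {u : Fin 2 → ℂ} (hu : ‖u 0‖ ^ 2 + ‖u 1‖ ^ 2 = 1) :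
    ∃ a ∈ unitaryGroup (Fin 2) ℂ, a.det = 1 ∧ ∀ i, a i 0 = u i := by
  have h : u 0 * star (u 0) + u 1 * star (u 1) = 1 := by
    simp only [Complex.star_def, Complex.mul_conj']
    exact_mod_cast hu
  refine ⟨!![u 0, -star (u 1); u 1, star (u 0)], ?_, ?_, ?_⟩
  · rw [mem_unitaryGroup_iff', star_eq_conjTranspose]
    ext i j
    fin_cases i <;> fin_cases j <;> simp [mul_apply, Fin.sum_univ_two] <;>
      simp only [Complex.star_def] at h <;> first | ring1 | linear_combination h
  · rw [det_fin_two]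
    simp only [of_apply, cons_val', cons_val_zero, cons_val_one, cons_val_fin_one]
    linear_combination h
  · intro i
    fin_cases i <;> simp

/-- A unit vector on which the determinant vanishes is a product vector. -/
theorem exists_product_vector {w : Fin 2 × Fin 2 → ℂ} (hn : ∑ x, ‖w x‖ ^ 2 = 1)
    (hdet : w (0, 0) * w (1, 1) = w (0, 1) * w (1, 0)) :
    ∃ u v : Fin 2 → ℂ, ‖u 0‖ ^ 2 + ‖u 1‖ ^ 2 = 1 ∧ ‖v 0‖ ^ 2 + ‖v 1‖ ^ 2 = 1 ∧
      ∀ i j, w (i, j) = u i * v j := by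
  have hsing : ∀ k i l j, w (k, l) * w (i, j) = w (k, j) * w (i, l) := by
    intro k i l j
    fin_cases k <;> fin_cases i <;> fin_cases l <;> fin_cases j <;>
      simp only [Fin.zero_eta, Fin.mk_one] <;> first | ring1 | linear_combination hdet |
        linear_combination -hdet
  obtain ⟨i, hi⟩ : ∃ i, 0 < ‖w (i, 0)‖ ^ 2 + ‖w (i, 1)‖ ^ 2 := by
    by_contra! hcon
    have h0 := hcon 0
    have h1 := hcon 1
    simp only [Fintype.sum_prod_type, Fin.sum_univ_two] at hn
    linarith
  set r : ℝ := ‖w (i, 0)‖ ^ 2 + ‖w (i, 1)‖ ^ 2 with hr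
  have hρ : √r ^ 2 = r := Real.sq_sqrt hi.le
  have hρ0 : 0 < √r := Real.sqrt_pos.2 hi
  have hrc : w (i, 0) * star (w (i, 0)) + w (i, 1) * star (w (i, 1)) = (r : ℂ) := by
    simp only [Complex.star_def, Complex.mul_conj', hr]
    push_cast
    ring
  have hρc : ((√r : ℝ) : ℂ) ^ 2 = (r : ℂ) := by exact_mod_cast hρ
  have hρc0 : ((√r : ℝ) : ℂ) ≠ 0 := by exact_mod_cast hρ0.ne'
  let v : Fin 2 → ℂ := fun j => w (i, j) / (√r : ℝ)
  let u : Fin 2 → ℂ := fun k => (w (k, 0) * star (w (i, 0)) + w (k, 1) * star (w (i, 1))) / (√r : ℝ)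
  have huv : ∀ k j, w (k, j) = u k * v j := by
    intro k j
    simp only [u, v]
    rw [div_mul_div_comm, ← sq, hρc, eq_div_iff (by exact_mod_cast hi.ne'), ← hrc]
    linear_combination (-star (w (i, 0))) * hsing k i 0 j - star (w (i, 1)) * hsing k i 1 j
  have hv : ‖v 0‖ ^ 2 + ‖v 1‖ ^ 2 = 1 := by
    simp only [v, norm_div, Complex.norm_real, Real.norm_of_nonneg hρ0.le, div_pow, hρ]
    rw [← add_div, ← hr, div_self hi.ne']
  refine ⟨u, v, ?_, hv, huv⟩
  simp only [Fintype.sum_prod_type, Fin.sum_univ_two, huv, norm_mul, mul_pow] at hn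
  have : (‖u 0‖ ^ 2 + ‖u 1‖ ^ 2) * (‖v 0‖ ^ 2 + ‖v 1‖ ^ 2) = 1 := by linarith
  rwa [hv, mul_one] at this

theorem sum_normSq_col {W : Matrix (Fin 2 × Fin 2) (Fin 2 × Fin 2) ℂ}
    (hW : W ∈ unitaryGroup (Fin 2 × Fin 2) ℂ) (y : Fin 2 × Fin 2) : ∑ x, ‖W x y‖ ^ 2 = 1 := by
  have h := congrFun (congrFun (mem_unitaryGroup_iff'.1 hW) y) y
  simp only [star_eq_conjTranspose, mul_apply, conjTranspose_apply, one_apply_eq,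
    Complex.star_def, Complex.conj_mul'] at h
  exact_mod_cast h

theorem sum_normSq_row {W : Matrix (Fin 2 × Fin 2) (Fin 2 × Fin 2) ℂ}
    (hW : W ∈ unitaryGroup (Fin 2 × Fin 2) ℂ) (x : Fin 2 × Fin 2) : ∑ y, ‖W x y‖ ^ 2 = 1 := by
  have h := congrFun (congrFun (mem_unitaryGroup_iff.1 hW) x) x
  simp only [star_eq_conjTranspose, mul_apply, conjTranspose_apply, one_apply_eq,
    Complex.star_def, Complex.mul_conj'] at h
  exact_mod_cast h

theorem det_of_corners {W : Matrix (Fin 2 × Fin 2) (Fin 2 × Fin 2) ℂ} {p q r s : ℂ}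
    (hW : W.submatrix finProdFinEquiv.symm finProdFinEquiv.symm
      = !![1, 0, 0, 0; 0, p, q, 0; 0, r, s, 0; 0, 0, 0, 1]) :
    W.det = p * s - q * r := by
  rw [← det_submatrix_equiv_self finProdFinEquiv.symm W, hW]
  simp [det_succ_row_zero, Fin.sum_univ_succ, Fin.succAbove]
  ring

/-- The stabilizer of `|00⟩` among the unitaries of determinant one that preserve the determinant
form consists of local gates. -/
theorem exists_local_of_fix {W : Matrix (Fin 2 × Fin 2) (Fin 2 × Fin 2) ℂ}
    (hW : W ∈ unitaryGroup (Fin 2 × Fin 2) ℂ) (hJ : Wᵀ * detForm * W = detForm)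
    (hdet : W.det = 1) (h00 : ∀ x, W x (0, 0) = if x = (0, 0) then 1 else 0) :
    ∃ a ∈ unitaryGroup (Fin 2) ℂ, ∃ b ∈ unitaryGroup (Fin 2) ℂ, W = a ⊗ₖ b := by
  have hform := fun x y => (transpose_mul_detForm_mul_apply W x y).symm.trans
    (congrFun (congrFun hJ x) y)
  have c0 : W (0, 0) (0, 0) = 1 := by simp [h00]
  have c1 : W (0, 1) (0, 0) = 0 := by simp [h00]
  have c2 : W (1, 0) (0, 0) = 0 := by simp [h00]
  have c3 : W (1, 1) (0, 0) = 0 := by simp [h00]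
  have r31 : W (1, 1) (0, 1) = 0 := by
    have := hform (0, 0) (0, 1); simpa [c0, c1, c2, c3, detForm, symplectic] using this
  have r32 : W (1, 1) (1, 0) = 0 := by
    have := hform (0, 0) (1, 0); simpa [c0, c1, c2, c3, detForm, symplectic] using this
  have r33 : W (1, 1) (1, 1) = 1 := by
    have := hform (0, 0) (1, 1); simpa [c0, c1, c2, c3, detForm, symplectic] using this
  have hrow := sum_normSq_row hW (0, 0)
  have hcol := sum_normSq_col hW (1, 1)
  simp only [Fintype.sum_prod_type, Fin.sum_univ_two, c0, r33, norm_one] at hrow hcol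
  have z : ∀ c : ℂ, ‖c‖ ^ 2 ≤ 0 → c = 0 := fun c hc => by
    have : ‖c‖ ^ 2 = 0 := le_antisymm hc (sq_nonneg _)
    simpa using this
  have n1 := sq_nonneg ‖W (0, 0) (0, 1)‖
  have n2 := sq_nonneg ‖W (0, 0) (1, 0)‖
  have n3 := sq_nonneg ‖W (0, 0) (1, 1)‖
  have n4 := sq_nonneg ‖W (0, 1) (1, 1)‖
  have n5 := sq_nonneg ‖W (1, 0) (1, 1)‖
  have r01 : W (0, 0) (0, 1) = 0 := z _ (by linarith)
  have r02 : W (0, 0) (1, 0) = 0 := z _ (by linarith)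
  have r03 : W (0, 0) (1, 1) = 0 := z _ (by linarith)
  have r13 : W (0, 1) (1, 1) = 0 := z _ (by linarith)
  have r23 : W (1, 0) (1, 1) = 0 := z _ (by linarith)
  set p := W (0, 1) (0, 1) with hp
  set q := W (0, 1) (1, 0) with hq
  set r := W (1, 0) (0, 1) with hr
  set s := W (1, 0) (1, 0) with hs
  have f1 : p * r = 0 := by
    have h := hform (0, 1) (0, 1)
    simp [r01, r31, detForm, symplectic, ← hp, ← hr] at h
    linear_combination (-1 / 2) * h
  have f2 : q * s = 0 := by
    have h := hform (1, 0) (1, 0)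
    simp [r02, r32, detForm, symplectic, ← hq, ← hs] at h
    linear_combination (-1 / 2) * h
  have f3 : p * s + q * r = 1 := by
    have h := hform (0, 1) (1, 0)
    simp [r01, r31, r02, r32, detForm, symplectic, ← hp, ← hr, ← hq, ← hs] at h
    linear_combination (-1) * h
  have f4 : p * s - q * r = 1 := by
    rw [← hdet]
    refine (det_of_corners ?_).symm
    ext i j
    fin_cases i <;> fin_cases j <;>
      simp [finProdFinEquiv, Fin.divNat, Fin.modNat, c0, c1, c2, c3, r31, r32, r33, r01, r02, r03,
        r13, r23, hp, hq, hr, hs]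
  have hps : p * s = 1 := by linear_combination (f3 + f4) / 2
  have hp0 : p ≠ 0 := left_ne_zero_of_mul_eq_one hps
  have hs0 : s ≠ 0 := right_ne_zero_of_mul_eq_one hps
  have hr0 : r = 0 := (mul_eq_zero.1 f1).resolve_left hp0
  have hq0 : q = 0 := (mul_eq_zero.1 f2).resolve_right hs0
  have hdiag : ∀ c : ℂ, ‖c‖ ^ 2 = 1 → diagonal ![1, c] ∈ unitaryGroup (Fin 2) ℂ := by
    intro c hc
    have hc1 : ‖c‖ = 1 := (pow_eq_one_iff_of_nonneg (norm_nonneg _) two_ne_zero).1 hc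
    refine diagonal_mem_unitaryGroup fun i => ?_
    fin_cases i <;> simp [hc1]
  have np : ‖p‖ ^ 2 = 1 := by
    have h := sum_normSq_col hW (0, 1)
    simpa [Fintype.sum_prod_type, Fin.sum_univ_two, r01, r31, ← hp, ← hr, hr0] using h
  have ns : ‖s‖ ^ 2 = 1 := by
    have h := sum_normSq_col hW (1, 0)
    simpa [Fintype.sum_prod_type, Fin.sum_univ_two, r02, r32, ← hs, ← hq, hq0] using h
  refine ⟨diagonal ![1, s], hdiag s ns, diagonal ![1, p], hdiag p np, ?_⟩
  ext ⟨i, j⟩ ⟨k, l⟩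
  fin_cases i <;> fin_cases j <;> fin_cases k <;> fin_cases l <;>
    simp [c0, c1, c2, c3, r31, r32, r33, r01, r02, r03, r13, r23, ← hp, ← hq, ← hr, ← hs, hr0, hq0,
      mul_comm s p, hps]

/-- A unitary of determinant one that preserves the determinant form is a local gate
(the surjectivity of `SU(2) × SU(2) → SO(4)`). -/
theorem exists_local {W : Matrix (Fin 2 × Fin 2) (Fin 2 × Fin 2) ℂ}
    (hW : W ∈ unitaryGroup (Fin 2 × Fin 2) ℂ) (hJ : Wᵀ * detForm * W = detForm)
    (hdet : W.det = 1) :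
    ∃ a ∈ unitaryGroup (Fin 2) ℂ, ∃ b ∈ unitaryGroup (Fin 2) ℂ, W = a ⊗ₖ b := by
  -- `|00⟩` is isotropic, hence so is its image, which is therefore a product vector
  obtain ⟨u, v, hu, hv, huv⟩ := exists_product_vector (w := fun x => W x (0, 0))
    (sum_normSq_col hW _) (by
      have h := (transpose_mul_detForm_mul_apply W (0, 0) (0, 0)).symm.trans
        (congrFun (congrFun hJ _) _)
      simp only [detForm, symplectic, kroneckerMap_apply, of_apply, cons_val', cons_val_zero,
        cons_val_fin_one, mul_zero] at h
      linear_combination h / 2)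
  obtain ⟨a, ha, hda, hau⟩ := exists_special_unitary_column hu
  obtain ⟨b, hb, hdb, hbv⟩ := exists_special_unitary_column hv
  have hK := kronecker_mem ha hb
  have hK2 : (a ⊗ₖ b) * (a ⊗ₖ b)ᴴ = 1 := mem_unitaryGroup_iff.1 hK
  have hK1 : (a ⊗ₖ b)ᴴ * (a ⊗ₖ b) = 1 := mem_unitaryGroup_iff'.1 hK
  have hdK : (a ⊗ₖ b)ᴴ.det = 1 := by
    rw [det_conjTranspose, det_kronecker, hda, hdb]; simp
  obtain ⟨c, hc, d, hd, hcd⟩ := exists_local_of_fix (W := (a ⊗ₖ b)ᴴ * W)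
    (mul_mem (Unitary.star_mem hK) hW)
    (by
      rw [transpose_mul, show Wᵀ * (a ⊗ₖ b)ᴴᵀ * detForm * ((a ⊗ₖ b)ᴴ * W)
        = Wᵀ * ((a ⊗ₖ b)ᴴᵀ * detForm * (a ⊗ₖ b)ᴴ) * W by simp only [Matrix.mul_assoc],
        conjTranspose_kronecker, kronecker_transpose_mul_detForm_mul, det_conjTranspose,
        det_conjTranspose, hda, hdb]
      simpa using hJ)
    (by rw [det_mul, hdK, hdet, one_mul])
    (by
      intro x
      have h1 := congrFun (congrFun hK1 x) (0, 0)
      rw [one_apply] at h1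
      rw [← h1, mul_apply, mul_apply]
      refine Finset.sum_congr rfl fun y _ => ?_
      rw [kroneckerMap_apply, hau, hbv]
      congr 1
      exact huv y.1 y.2)
  refine ⟨a * c, mul_mem ha hc, b * d, mul_mem hb hd, ?_⟩
  rw [mul_kronecker_mul, ← hcd, ← Matrix.mul_assoc, hK2, Matrix.one_mul]

/-- The magic basis: Bell states with phases chosen such that the determinant form becomes the
standard symmetric form. -/
noncomputable def magic : Matrix (Fin 2 × Fin 2) (Fin 2 × Fin 2) ℂ :=
  cnotMatrix * (hadamard ⊗ₖ 1) * diagonal fun x => if x.1 = x.2 then 1 else Complex.I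

theorem cnotMatrix_conjTranspose : cnotMatrixᴴ = cnotMatrix := by
  ext ⟨i, j⟩ ⟨k, l⟩
  fin_cases i <;> fin_cases j <;> fin_cases k <;> fin_cases l <;> simp [cnotMatrix]

theorem cnotMatrix_mul_cnotMatrix : cnotMatrix * cnotMatrix = 1 := by
  ext ⟨i, j⟩ ⟨k, l⟩
  fin_cases i <;> fin_cases j <;> fin_cases k <;> fin_cases l <;>
    simp [cnotMatrix, mul_apply]

theorem cnotMatrix_mem : cnotMatrix ∈ unitaryGroup (Fin 2 × Fin 2) ℂ := by
  rw [mem_unitaryGroup_iff, star_eq_conjTranspose, cnotMatrix_conjTranspose,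
    cnotMatrix_mul_cnotMatrix]

theorem magic_mem : magic ∈ unitaryGroup (Fin 2 × Fin 2) ℂ :=
  mul_mem (mul_mem cnotMatrix_mem (kronecker_mem hadamard_mem (one_mem _)))
    (diagonal_mem_unitaryGroup fun x => by split_ifs <;> simp)

theorem magic_apply (x y : Fin 2 × Fin 2) : magic x y =
    (1 / (√2 : ℝ) : ℂ) * (if x.1 + x.2 = y.2 then
      (if y.1 = y.2 then 1 else Complex.I) * (if x.1 = 1 ∧ y.1 = 1 then -1 else 1) else 0) := by
  obtain ⟨i, j⟩ := x
  obtain ⟨k, l⟩ := y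
  fin_cases i <;> fin_cases j <;> fin_cases k <;> fin_cases l <;>
    simp [magic, cnotMatrix, hadamard, mul_apply, Fintype.sum_prod_type, Fin.sum_univ_two,
      one_apply, diagonal_apply]

theorem magic_mul_transpose : magic * magicᵀ = detForm := by
  have h := sqrt_two_inv_mul_self
  set c : ℂ := (1 / (√2 : ℝ) : ℂ) with hc
  ext ⟨i, j⟩ ⟨k, l⟩
  simp only [mul_apply, transpose_apply, magic_apply, ← hc, Fintype.sum_prod_type,
    Fin.sum_univ_two]
  fin_cases i <;> fin_cases j <;> fin_cases k <;> fin_cases l <;>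
    simp [detForm, symplectic, h] <;> norm_num <;> ring_nf <;>
    simp only [sq, h, Complex.I_mul_I] <;> norm_num

theorem exists_sq_of_norm_one {z : ℂ} (hz : ‖z‖ = 1) : ∃ w : ℂ, ‖w‖ = 1 ∧ w ^ 2 = z := by
  obtain ⟨w, hw⟩ := IsSquare.exists_sq z (IsAlgClosed.exists_pow_nat_eq z two_pos |>.elim
    fun w hw => ⟨w, by rw [← hw, sq]⟩)
  refine ⟨w, ?_, hw.symm⟩
  have h : ‖w‖ ^ 2 = 1 := by rw [← norm_pow, ← hw, hz]
  exact (pow_eq_one_iff_of_nonneg (norm_nonneg _) two_ne_zero).1 h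

theorem mul_star_of_norm_one {z : ℂ} (hz : ‖z‖ = 1) : z * star z = 1 := by
  rw [Complex.star_def, Complex.mul_conj', hz]; simp

/-- A phase `t` making `t² p + t⁻² q` real: rotate `p - q̄` onto the real axis. -/
theorem exists_phase_real (p q : ℂ) :
    ∃ t : ℂ, ‖t‖ = 1 ∧ (t ^ 2 * p + star t ^ 2 * q).im = 0 := by
  set w := p - star q with hw
  obtain ⟨z, hz, hzw⟩ : ∃ z : ℂ, ‖z‖ = 1 ∧ (z * w).im = 0 := by
    by_cases h0 : w = 0
    · exact ⟨1, by simp, by simp [h0]⟩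
    · refine ⟨star w / ‖w‖, ?_, ?_⟩
      · rw [norm_div, norm_star, Complex.norm_real, norm_norm, div_self (norm_ne_zero_iff.2 h0)]
      · rw [div_mul_eq_mul_div, Complex.star_def, Complex.conj_mul', ← Complex.ofReal_pow,
          ← Complex.ofReal_div, Complex.ofReal_im]
  obtain ⟨t, ht, rfl⟩ := exists_sq_of_norm_one hz
  refine ⟨t, ht, ?_⟩
  have h1 : t ^ 2 * p + star t ^ 2 * q = t ^ 2 * w + (star (star t ^ 2 * q) + star t ^ 2 * q) := by
    rw [hw, star_mul', star_pow, star_star]; ring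
  rw [h1, Complex.add_im, hzw, zero_add]
  generalize star t ^ 2 * q = z
  simp

/-- Four unimodular numbers with product `1` and real sum form two reciprocal pairs. -/
theorem exists_reciprocal_pairs {d : Fin 2 × Fin 2 → ℂ} (hd : ∀ x, ‖d x‖ = 1)
    (hprod : ∏ x, d x = 1) (hsum : (∑ x, d x).im = 0) :
    ∃ σ : Equiv.Perm (Fin 2 × Fin 2),
      d (σ (0, 0)) * d (σ (1, 1)) = 1 ∧ d (σ (0, 1)) * d (σ (1, 0)) = 1 := by
  simp only [Fintype.prod_prod_type, Fin.prod_univ_two, Fintype.sum_prod_type,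
    Fin.sum_univ_two] at hprod hsum
  set a := d (0, 0)
  set b := d (1, 1)
  set c := d (0, 1)
  set e := d (1, 0)
  have hs := Complex.conj_eq_iff_im.2 hsum
  have ha : a * star a = 1 := mul_star_of_norm_one (hd _)
  have hb : b * star b = 1 := mul_star_of_norm_one (hd _)
  have hc : c * star c = 1 := mul_star_of_norm_one (hd _)
  have he : e * star e = 1 := mul_star_of_norm_one (hd _)
  have ha' : star a = b * c * e := by linear_combination (b * c * e) * ha - star a * hprod
  have hb' : star b = a * c * e := by linear_combination (a * c * e) * hb - star b * hprod
  have hc' : star c = a * b * e := by linear_combination (a * b * e) * hc - star c * hprod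
  have he' : star e = a * b * c := by linear_combination (a * b * c) * he - star e * hprod
  simp only [map_add, ← Complex.star_def, ha', hb', hc', he'] at hs
  have key : (a * b - 1) * ((a * c - 1) * (a * e - 1)) = 0 := by
    linear_combination (a ^ 2 + 1) * hprod - a * hs
  rcases mul_eq_zero.1 key with h | h
  · have h1 : a * b = 1 := sub_eq_zero.1 h
    exact ⟨1, h1, by change c * e = 1; linear_combination hprod - c * e * h1⟩
  rcases mul_eq_zero.1 h with h | h
  · have h1 : a * c = 1 := sub_eq_zero.1 h
    refine ⟨Equiv.swap (0, 1) (1, 1), ?_, ?_⟩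
    · rw [Equiv.swap_apply_of_ne_of_ne (by decide) (by decide), Equiv.swap_apply_right]
      exact h1
    · rw [Equiv.swap_apply_left, Equiv.swap_apply_of_ne_of_ne (by decide) (by decide)]
      change b * e = 1
      linear_combination hprod - b * e * h1
  · have h1 : a * e = 1 := sub_eq_zero.1 h
    refine ⟨Equiv.swap (1, 0) (1, 1), ?_, ?_⟩
    · rw [Equiv.swap_apply_of_ne_of_ne (by decide) (by decide), Equiv.swap_apply_right]
      exact h1
    · rw [Equiv.swap_apply_left, Equiv.swap_apply_of_ne_of_ne (by decide) (by decide)]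
      change c * b = 1
      linear_combination hprod - b * c * h1

theorem detForm_map_star : detForm.map star = detForm := by
  ext ⟨i, j⟩ ⟨k, l⟩
  fin_cases i <;> fin_cases j <;> fin_cases k <;> fin_cases l <;> simp [detForm, symplectic]

theorem magic_conjTranspose_transpose_mul : magicᴴᵀ * magicᴴ = detForm := by
  have h := congrArg (fun X => X.map star) magic_mul_transpose
  rw [detForm_map_star] at h
  rw [← h]
  ext i j
  simp [mul_apply]

theorem magic_transpose_mul_detForm_mul : magicᵀ * detForm * magic = 1 := by
  have h1 : magicᴴ * magic = 1 := mem_unitaryGroup_iff'.1 magic_mem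
  rw [← magic_conjTranspose_transpose_mul, Matrix.mul_assoc, Matrix.mul_assoc, h1, Matrix.mul_one,
    ← transpose_mul, h1, transpose_one]

/-- In the magic basis, complex orthogonal unitaries of determinant one are local gates. -/
theorem exists_local_of_orthogonal {K : Matrix (Fin 2 × Fin 2) (Fin 2 × Fin 2) ℂ}
    (hK : K ∈ unitaryGroup (Fin 2 × Fin 2) ℂ) (hKT : Kᵀ * K = 1) (hdet : K.det = 1) :
    ∃ a ∈ unitaryGroup (Fin 2) ℂ, ∃ b ∈ unitaryGroup (Fin 2) ℂ,
      magic * K * magicᴴ = a ⊗ₖ b := by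
  have h2 : magic * magicᴴ = 1 := mem_unitaryGroup_iff.1 magic_mem
  refine exists_local (mul_mem (mul_mem magic_mem hK) (Unitary.star_mem magic_mem)) ?_ ?_
  · rw [transpose_mul, transpose_mul]
    calc magicᴴᵀ * (Kᵀ * magicᵀ) * detForm * (magic * K * magicᴴ)
        = magicᴴᵀ * (Kᵀ * (magicᵀ * detForm * magic) * K) * magicᴴ := by
          simp only [Matrix.mul_assoc]
      _ = detForm := by
          rw [magic_transpose_mul_detForm_mul, Matrix.mul_one, hKT, Matrix.mul_one,
            magic_conjTranspose_transpose_mul]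
  · have := congrArg det h2
    rw [det_mul, det_one] at this
    rw [det_mul, det_mul, hdet, mul_one, this]

theorem trace_mul_detForm (X : Matrix (Fin 2 × Fin 2) (Fin 2 × Fin 2) ℂ) :
    (X * detForm).trace = X (0, 0) (1, 1) - X (0, 1) (1, 0) - X (1, 0) (0, 1)
      + X (1, 1) (0, 0) := by
  simp [trace, mul_apply, detForm, symplectic, Fintype.sum_prod_type, Fin.sum_univ_two]
  ring

/-- Multiplying by a suitable diagonal makes the determinant `1` and the trace of the associated
symmetric matrix `S = Uᵀ J U J` real. -/
theorem exists_diagonal_normalization {U : Matrix (Fin 2 × Fin 2) (Fin 2 × Fin 2) ℂ}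
    (hU : U ∈ unitaryGroup (Fin 2 × Fin 2) ℂ) :
    ∃ d : Fin 2 × Fin 2 → ℂ, (∀ x, ‖d x‖ = 1) ∧ (U * diagonal d).det = 1 ∧
      ((U * diagonal d)ᵀ * detForm * (U * diagonal d) * detForm).trace.im = 0 := by
  have hUd : ‖U.det‖ = 1 := by
    have := congrArg det (mem_unitaryGroup_iff.1 hU)
    rw [det_mul, star_eq_conjTranspose, det_conjTranspose, det_one, Complex.star_def,
      Complex.mul_conj'] at this
    have h1 : ‖U.det‖ ^ 2 = 1 := by exact_mod_cast this
    exact (pow_eq_one_iff_of_nonneg (norm_nonneg _) two_ne_zero).1 h1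
  obtain ⟨c₂, hc₂, e₂⟩ := exists_sq_of_norm_one (z := star U.det) (by rw [norm_star, hUd])
  obtain ⟨c, hc, e⟩ := exists_sq_of_norm_one hc₂
  have hc4 : U.det * c ^ 4 = 1 := by
    rw [show c ^ 4 = (c ^ 2) ^ 2 by ring, e, e₂, mul_star_of_norm_one hUd]
  set T := Uᵀ * detForm * U with hT
  obtain ⟨t, ht, him⟩ := exists_phase_real (c ^ 2 * (T (0, 0) (1, 1) + T (1, 1) (0, 0)))
    (-(c ^ 2 * (T (0, 1) (1, 0) + T (1, 0) (0, 1))))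
  have htt := mul_star_of_norm_one ht
  refine ⟨fun x => c * if x.1 = x.2 then t else star t, fun x => ?_, ?_, ?_⟩
  · dsimp only
    split_ifs <;> simp [hc, ht, -RCLike.star_def]
  · rw [det_mul, det_diagonal]
    simp only [Fintype.prod_prod_type, Fin.prod_univ_two]
    simp only [if_true, Fin.zero_eq_one_iff, Fin.one_eq_zero_iff, if_false,
      OfNat.ofNat_ne_one]
    linear_combination hc4 + U.det * c ^ 4 * (t * star t + 1) * htt
  · rw [← him, transpose_mul, diagonal_transpose, show ∀ D : Matrix _ _ ℂ,
      D * Uᵀ * detForm * (U * D) * detForm = D * T * D * detForm by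
        intro D; simp only [hT, Matrix.mul_assoc]]
    congr 1
    rw [trace_mul_detForm]
    simp only [diagonal_mul, mul_diagonal]
    simp
    ring

theorem det_mul_self_of_orthogonal {n : Type*} [Fintype n] [DecidableEq n] {V : Matrix n n ℂ}
    (hV : Vᵀ * V = 1) : V.det * V.det = 1 := by
  have := congrArg det hV
  rwa [det_mul, det_transpose, det_one] at this

/-- A symmetric unitary `S` of determinant one and real trace is diagonalized by a special
orthogonal matrix, with the eigenvalues ordered into reciprocal pairs. -/
theorem exists_special_orthogonal_diagonalization
    {S : Matrix (Fin 2 × Fin 2) (Fin 2 × Fin 2) ℂ} (hSm : S ∈ unitaryGroup (Fin 2 × Fin 2) ℂ)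
    (hsym : Sᵀ = S) (hdet : S.det = 1) (htr : S.trace.im = 0) :
    ∃ O ∈ unitaryGroup (Fin 2 × Fin 2) ℂ, Oᵀ * O = 1 ∧ O.det = 1 ∧
      ∃ l : Fin 2 × Fin 2 → ℂ, (∀ x, ‖l x‖ = 1) ∧ l (0, 0) * l (1, 1) = 1 ∧
        l (0, 1) * l (1, 0) = 1 ∧ S = O * diagonal l * Oᵀ := by
  obtain ⟨V, hV, hVT, l, hl, hS⟩ := exists_orthogonal_diagonalization hSm hsym
  have hV2 : V * Vᵀ = 1 := by rw [hVT]; exact mem_unitaryGroup_iff.1 hV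
  have hV1 : Vᵀ * V = 1 := mul_eq_one_comm.1 hV2
  have hVdet := det_mul_self_of_orthogonal hV1
  have hprod : ∏ x, l x = 1 := by
    have h := congrArg det hS
    rw [hdet, det_mul, det_mul, det_transpose, det_diagonal] at h
    linear_combination (-∏ x, l x) * hVdet - h
  have hsum : (∑ x, l x).im = 0 := by
    have h := congrArg trace hS
    rw [trace_mul_comm (V * diagonal l), ← Matrix.mul_assoc, hV1, Matrix.one_mul,
      trace_diagonal] at h
    rw [← h, htr]
  obtain ⟨σ, hσ₁, hσ₂⟩ := exists_reciprocal_pairs hl hprod hsum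
  -- permute the eigenvectors into pairs, then flip one sign to get determinant one
  obtain ⟨V', hV'⟩ : ∃ V', V' = V.submatrix id σ := ⟨_, rfl⟩
  have hV'1 : V'ᵀ * V' = 1 := by
    have h := congrArg (fun X => X.submatrix σ σ) hV1
    simp only [submatrix_one_equiv] at h
    rw [← h, hV', transpose_submatrix]
    exact (submatrix_mul Vᵀ V σ id σ Function.bijective_id).symm
  have hV'S : S = V' * diagonal (l ∘ σ) * V'ᵀ := by
    rw [hS, hV', transpose_submatrix, ← submatrix_diagonal_equiv, submatrix_mul_equiv,
      submatrix_mul_equiv, submatrix_id_id]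
  have hV'd := det_mul_self_of_orthogonal hV'1
  have hV'T : V'ᵀ = V'ᴴ := by
    ext i j
    rw [hV']
    exact congrFun (congrFun hVT (σ i)) j
  obtain ⟨ε, hε⟩ : ∃ ε : Fin 2 × Fin 2 → ℂ, ε = fun x => if x = (0, 0) then V'.det else 1 :=
    ⟨_, rfl⟩
  have hεε : ∀ x, ε x * ε x = 1 := fun x => by
    rw [hε]; dsimp only; split_ifs <;> simp [hV'd]
  have hEE : diagonal ε * diagonal ε = 1 := by
    rw [diagonal_mul_diagonal]; simp [hεε]
  have hdetε : (diagonal ε).det = V'.det := by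
    rw [det_diagonal, hε, Fintype.prod_ite_eq']
  have hεn : ∀ x, ‖ε x‖ = 1 := fun x => by
    have h := congrArg norm (hεε x)
    rw [norm_mul, norm_one, ← sq] at h
    exact (pow_eq_one_iff_of_nonneg (norm_nonneg _) two_ne_zero).1 h
  refine ⟨V' * diagonal ε, mul_mem ?_ (diagonal_mem_unitaryGroup hεn), ?_, ?_, l ∘ σ,
    fun x => hl _, hσ₁, hσ₂, ?_⟩
  · rw [mem_unitaryGroup_iff', star_eq_conjTranspose, ← hV'T, hV'1]
  · rw [transpose_mul, diagonal_transpose, Matrix.mul_assoc, ← Matrix.mul_assoc _ V', hV'1,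
      Matrix.one_mul, hEE]
  · rw [det_mul, hdetε, hV'd]
  · rw [transpose_mul, diagonal_transpose, hV'S,
      show ∀ D : Matrix _ _ ℂ, V' * diagonal ε * D * (diagonal ε * V'ᵀ)
        = V' * (diagonal ε * D * diagonal ε) * V'ᵀ by intro D; simp only [Matrix.mul_assoc],
      diagonal_mul_diagonal, diagonal_mul_diagonal]
    congr 3
    ext x
    linear_combination (-(l ∘ σ) x) * hεε x

/-- A diagonal with reciprocal pairs of unimodular entries has a local diagonal square root of
determinant one. -/
theorem exists_local_sqrt {l : Fin 2 × Fin 2 → ℂ} (hl : ∀ x, ‖l x‖ = 1)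
    (h₁ : l (0, 0) * l (1, 1) = 1) (h₂ : l (0, 1) * l (1, 0) = 1) :
    ∃ l₁ ∈ unitaryGroup (Fin 2) ℂ, ∃ l₂ ∈ unitaryGroup (Fin 2) ℂ, ∃ D : Fin 2 × Fin 2 → ℂ,
      l₁ ⊗ₖ l₂ = diagonal D ∧ diagonal D * diagonal D = diagonal l ∧ (diagonal D).det = 1 := by
  obtain ⟨m₀, hm₀, em₀⟩ := exists_sq_of_norm_one (hl (0, 0))
  obtain ⟨m₁, hm₁, em₁⟩ := exists_sq_of_norm_one (hl (0, 1))
  obtain ⟨μ, hμ, eμ⟩ := exists_sq_of_norm_one (z := m₀ * m₁) (by rw [norm_mul, hm₀, hm₁, one_mul])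
  obtain ⟨ν, hν⟩ : ∃ ν, ν = m₀ * star μ := ⟨_, rfl⟩
  have hνn : ‖ν‖ = 1 := by rw [hν, norm_mul, norm_star, hm₀, hμ, one_mul]
  have hm₀s := mul_star_of_norm_one hm₀
  have hm₁s := mul_star_of_norm_one hm₁
  have hμs := mul_star_of_norm_one hμ
  have hνs := mul_star_of_norm_one hνn
  refine ⟨diagonal ![μ, star μ], diagonal_mem_unitaryGroup fun i => ?_, diagonal ![ν, star ν],
    diagonal_mem_unitaryGroup fun i => ?_, _, diagonal_kronecker_diagonal _ _, ?_, ?_⟩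
  · fin_cases i <;> simp [hμ, -RCLike.star_def]
  · fin_cases i <;> simp [hνn, -RCLike.star_def]
  · rw [diagonal_mul_diagonal]
    congr 1
    ext ⟨i, j⟩
    have hs3 : l (1, 1) = star m₀ ^ 2 := by
      linear_combination (star m₀ ^ 2) * h₁ - l (1, 1) * (m₀ * star m₀ + 1) * hm₀s
        + star m₀ ^ 2 * l (1, 1) * em₀
    have hs2 : l (1, 0) = star m₁ ^ 2 := by
      linear_combination (star m₁ ^ 2) * h₂ - l (1, 0) * (m₁ * star m₁ + 1) * hm₁s
        + star m₁ ^ 2 * l (1, 0) * em₁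
    have eμ' : star μ ^ 2 = star m₀ * star m₁ := by
      have := congrArg star eμ; rwa [star_pow, star_mul'] at this
    have hsν : star ν = star m₀ * μ := by rw [hν, star_mul', star_star]
    fin_cases i <;> fin_cases j <;>
      simp only [Fin.zero_eta, Fin.mk_one, cons_val_zero, cons_val_one, cons_val_fin_one]
    · rw [← em₀, hν]; linear_combination m₀ ^ 2 * (μ * star μ + 1) * hμs
    · rw [← em₁, hsν]
      linear_combination star m₀ ^ 2 * (μ ^ 2 + m₀ * m₁) * eμ
        + m₁ ^ 2 * (m₀ * star m₀ + 1) * hm₀s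
    · rw [hs2, hν]
      linear_combination m₀ ^ 2 * (star μ ^ 2 + star m₀ * star m₁) * eμ'
        + star m₁ ^ 2 * (m₀ * star m₀ + 1) * hm₀s
    · rw [hs3, hsν]; linear_combination star m₀ ^ 2 * (μ * star μ + 1) * hμs
  · rw [det_diagonal]
    simp only [Fintype.prod_prod_type, Fin.prod_univ_two, cons_val_zero, cons_val_one,
      cons_val_fin_one]
    linear_combination (1 + μ * star μ) * hμs
      + (μ * star μ) ^ 2 * (ν * star ν + 1) * hνs

/-- A diagonal local gate in the magic basis is an `XX`-`ZZ` interaction, which costs two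
C-NOTs. -/
theorem magic_mul_local_diagonal_mul {l₁ l₂ : Matrix (Fin 2) (Fin 2) ℂ} {D : Fin 2 × Fin 2 → ℂ}
    (h : l₁ ⊗ₖ l₂ = diagonal D) :
    magic * diagonal D * magicᴴ
      = cnotMatrix * ((hadamard * l₁ * hadamard) ⊗ₖ l₂) * cnotMatrix := by
  obtain ⟨m, hm⟩ : ∃ m : Fin 2 × Fin 2 → ℂ, m = fun x => if x.1 = x.2 then 1 else Complex.I :=
    ⟨_, rfl⟩
  have hDD : diagonal m * diagonal D * (diagonal m)ᴴ = diagonal D := by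
    rw [diagonal_conjTranspose, diagonal_mul_diagonal, diagonal_mul_diagonal]
    congr 1
    ext x
    have := mul_star_of_norm_one (z := m x) (by rw [hm]; dsimp only; split_ifs <;> simp)
    rw [Pi.star_apply]
    linear_combination D x * this
  rw [magic, conjTranspose_mul, conjTranspose_mul, cnotMatrix_conjTranspose,
    conjTranspose_kronecker, hadamard_conjTranspose, conjTranspose_one, ← hm]
  calc cnotMatrix * hadamard ⊗ₖ 1 * diagonal m * diagonal D
        * ((diagonal m)ᴴ * (hadamard ⊗ₖ 1 * cnotMatrix))
      = cnotMatrix * (hadamard ⊗ₖ 1 * (diagonal m * diagonal D * (diagonal m)ᴴ) * hadamard ⊗ₖ 1)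
        * cnotMatrix := by simp only [Matrix.mul_assoc]
    _ = _ := by
      rw [hDD, ← h, ← mul_kronecker_mul, ← mul_kronecker_mul, Matrix.one_mul, Matrix.mul_one]

/-- Every two-qubit unitary is, up to a diagonal on the input side, a circuit with two C-NOTs. -/
theorem exists_two_cnot {U : Matrix (Fin 2 × Fin 2) (Fin 2 × Fin 2) ℂ}
    (hU : U ∈ unitaryGroup (Fin 2 × Fin 2) ℂ) :
    ∃ a ∈ unitaryGroup (Fin 2) ℂ, ∃ b ∈ unitaryGroup (Fin 2) ℂ, ∃ c ∈ unitaryGroup (Fin 2) ℂ,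
    ∃ d ∈ unitaryGroup (Fin 2) ℂ, ∃ e ∈ unitaryGroup (Fin 2) ℂ, ∃ f ∈ unitaryGroup (Fin 2) ℂ,
    ∃ δ : Fin 2 × Fin 2 → ℂ, (∀ x, ‖δ x‖ = 1) ∧
      U = (a ⊗ₖ b) * cnotMatrix * (c ⊗ₖ d) * cnotMatrix * (e ⊗ₖ f) * diagonal δ := by
  obtain ⟨δ, hδ, hdet, htr⟩ := exists_diagonal_normalization hU
  obtain ⟨U₁, hU₁⟩ : ∃ U₁, U₁ = U * diagonal δ := ⟨_, rfl⟩
  rw [← hU₁] at hdet htr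
  have hU₁m : U₁ ∈ unitaryGroup (Fin 2 × Fin 2) ℂ :=
    hU₁ ▸ mul_mem hU (diagonal_mem_unitaryGroup hδ)
  have hM1 : magicᴴ * magic = 1 := mem_unitaryGroup_iff'.1 magic_mem
  have hM2 : magic * magicᴴ = 1 := mem_unitaryGroup_iff.1 magic_mem
  obtain ⟨G, hG⟩ : ∃ G, G = magicᴴ * U₁ * magic := ⟨_, rfl⟩
  have hGm : G ∈ unitaryGroup (Fin 2 × Fin 2) ℂ :=
    hG ▸ mul_mem (mul_mem (Unitary.star_mem magic_mem) hU₁m) magic_mem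
  have hMdet : magicᴴ.det * magic.det = 1 := by rw [← det_mul, hM1, det_one]
  have hGdet : G.det = 1 := by
    rw [hG, det_mul, det_mul, hdet, mul_one, hMdet]
  have hGT : Gᵀ * G = magicᵀ * (U₁ᵀ * detForm * U₁) * magic := by
    rw [hG, transpose_mul, transpose_mul, ← magic_conjTranspose_transpose_mul]
    simp only [Matrix.mul_assoc]
  obtain ⟨O, hO, hO1, hOdet, l, hl, hl₁, hl₂, hSO⟩ :=
    exists_special_orthogonal_diagonalization (mul_mem (transpose_mem_unitaryGroup hGm) hGm)
      (by rw [transpose_mul, transpose_transpose])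
      (by rw [det_mul, det_transpose, hGdet, mul_one])
      (by rw [hGT, trace_mul_comm, ← Matrix.mul_assoc, magic_mul_transpose, trace_mul_comm, htr])
  have hO2 : O * Oᵀ = 1 := mul_eq_one_comm.1 hO1
  obtain ⟨l₁, hl₁m, l₂, hl₂m, D, hD, hDD, hDdet⟩ := exists_local_sqrt hl hl₁ hl₂
  obtain ⟨L, hL⟩ : ∃ L, L = diagonal D := ⟨_, rfl⟩
  have hLm : L ∈ unitaryGroup (Fin 2 × Fin 2) ℂ := by rw [hL, ← hD]; exact kronecker_mem hl₁m hl₂m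
  have hLT : Lᴴᵀ = Lᴴ := by
    rw [hL, diagonal_conjTranspose, diagonal_transpose]
  have hL1 : Lᴴ * L = 1 := mem_unitaryGroup_iff'.1 hLm
  have hL2 : L * Lᴴ = 1 := mem_unitaryGroup_iff.1 hLm
  rw [← hL] at hDD hDdet
  obtain ⟨a, ha, b, hb, hab⟩ := exists_local_of_orthogonal (K := G * O * Lᴴ)
    (mul_mem (mul_mem hGm hO) (Unitary.star_mem hLm))
    (by
      rw [transpose_mul, transpose_mul, hLT, show Lᴴ * (Oᵀ * Gᵀ) * (G * O * Lᴴ)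
        = Lᴴ * (Oᵀ * (Gᵀ * G) * O) * Lᴴ by simp only [Matrix.mul_assoc], hSO,
        show Oᵀ * (O * diagonal l * Oᵀ) * O = (Oᵀ * O) * diagonal l * (Oᵀ * O) by
          simp only [Matrix.mul_assoc], hO1, Matrix.one_mul, Matrix.mul_one, ← hDD,
        ← Matrix.mul_assoc, hL1, Matrix.one_mul, hL2])
    (by rw [det_mul, det_mul, hGdet, hOdet, det_conjTranspose, hDdet]; simp)
  obtain ⟨e, he, f, hf, hef⟩ := exists_local_of_orthogonal (transpose_mem_unitaryGroup hO)
    (by rw [transpose_transpose, hO2]) (by rw [det_transpose, hOdet])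
  refine ⟨a, ha, b, hb, hadamard * l₁ * hadamard, mul_mem (mul_mem hadamard_mem hl₁m) hadamard_mem,
    l₂, hl₂m, e, he, f, hf, star δ, fun x => by rw [Pi.star_apply, norm_star, hδ], ?_⟩
  have hδδ : diagonal δ * diagonal (star δ) = 1 := by
    rw [← diagonal_conjTranspose]; exact mem_unitaryGroup_iff.1 (diagonal_mem_unitaryGroup hδ)
  calc U = U₁ * diagonal (star δ) := by rw [hU₁, Matrix.mul_assoc, hδδ, Matrix.mul_one]
    _ = (magic * (G * O * Lᴴ) * magicᴴ) * (magic * L * magicᴴ) * (magic * Oᵀ * magicᴴ)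
          * diagonal (star δ) := by
      congr 1
      calc U₁ = (magic * magicᴴ) * U₁ * (magic * magicᴴ) := by
            rw [hM2, Matrix.one_mul, Matrix.mul_one]
        _ = magic * G * magicᴴ := by rw [hG]; simp only [Matrix.mul_assoc]
        _ = magic * (G * (O * ((Lᴴ * L) * Oᵀ))) * magicᴴ := by
            rw [hL1, Matrix.one_mul, hO2, Matrix.mul_one]
        _ = magic * (G * (O * (Lᴴ * ((magicᴴ * magic) * (L * ((magicᴴ * magic) * Oᵀ)))))) *
              magicᴴ := by
            rw [hM1]; simp only [Matrix.mul_assoc, Matrix.one_mul]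
        _ = _ := by simp only [Matrix.mul_assoc]
    _ = _ := by
      rw [hab, hef, hL, magic_mul_local_diagonal_mul hD]
      simp only [Matrix.mul_assoc]

end TwoQubit

/-! ### Circuits and their matrices -/

namespace StatePrep

theorem Circuit.matrix_append {ι : Type*} [Fintype ι] [DecidableEq ι] (C C' : Circuit ι) :
    Circuit.matrix (C ++ C') = Circuit.matrix C' * Circuit.matrix C := by
  induction C with
  | nil => exact (Matrix.mul_one _).symm
  | cons g C ih =>
    change Circuit.matrix (C ++ C') * g.matrix = _ * (Circuit.matrix C * g.matrix)
    rw [ih, Matrix.mul_assoc]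

/-- The matrix `W` is implemented by a circuit with exactly `m` C-NOT gates. -/
def Implements {ι : Type*} [Fintype ι] [DecidableEq ι] (m : ℕ)
    (W : Matrix (Bits ι) (Bits ι) ℂ) : Prop :=
  ∃ C : Circuit ι, Circuit.matrix C = W ∧ C.cnotCount = m

namespace Implements

variable {ι κ : Type*} [Fintype ι] [DecidableEq ι] [Fintype κ] [DecidableEq κ]

theorem one : Implements 0 (1 : Matrix (Bits ι) (Bits ι) ℂ) := ⟨[], rfl, rfl⟩

theorem mul {m m' : ℕ} {W W' : Matrix (Bits ι) (Bits ι) ℂ} (h : Implements m W)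
    (h' : Implements m' W') : Implements (m + m') (W * W') := by
  obtain ⟨C, rfl, rfl⟩ := h
  obtain ⟨C', rfl, rfl⟩ := h'
  refine ⟨C' ++ C, Circuit.matrix_append _ _, ?_⟩
  simp [Circuit.cnotCount, add_comm]

theorem single (q : ι) (U : unitaryGroup (Fin 2) ℂ) :
    Implements 0 (Gate.single q U).matrix :=
  ⟨[.single q U], Matrix.one_mul _, rfl⟩

theorem cnot (c t : ι) (h : c ≠ t) : Implements 1 (Gate.cnot c t h).matrix :=
  ⟨[.cnot c t h], Matrix.one_mul _, rfl⟩

end Implements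

section Map

variable {ι κ : Type*}

/-- Relabelling of the qubits of a gate along an injection. -/
def Gate.map (f : κ → ι) (hf : Function.Injective f) : Gate κ → Gate ι
  | .single q U => .single (f q) U
  | .cnot c t h => .cnot (f c) (f t) (hf.ne h)

theorem Gate.isCNOT_map (f : κ → ι) (hf : Function.Injective f) (g : Gate κ) :
    (g.map f hf).isCNOT = g.isCNOT := by
  cases g <;> rfl

variable [Fintype ι] [DecidableEq ι] [Fintype κ] [DecidableEq κ]

open Classical in
/-- A relabelled gate acts on the qubits in the range as the original gate, and as the identity on
the others. -/
theorem Gate.matrix_map_apply (f : κ → ι) (hf : Function.Injective f) (g : Gate κ)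
    (x y : Bits ι) : (g.map f hf).matrix x y =
      if ∀ j ∉ Set.range f, x j = y j then g.matrix (x ∘ f) (y ∘ f) else 0 := by
  cases g with
  | single q U =>
    simp only [Gate.map, Gate.matrix, of_apply, Function.comp_apply]
    rw [← ite_and]
    refine if_congr ⟨fun h => ⟨fun j hj => h j fun e => hj ⟨q, e.symm⟩,
      fun j hj => h _ (hf.ne hj)⟩, fun ⟨h1, h2⟩ j hj => ?_⟩ rfl rfl
    by_cases hr : j ∈ Set.range f
    · obtain ⟨k, rfl⟩ := hr
      exact h2 k fun e => hj (congrArg f e)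
    · exact h1 j hr
  | cnot c t hct =>
    simp only [Gate.map, Gate.matrix, of_apply, Function.comp_apply]
    rw [← ite_and]
    refine if_congr ⟨fun h => ⟨fun j hj => ?_, ?_⟩, fun ⟨h1, h2⟩ => ?_⟩ rfl rfl
    · rw [h, Function.update_of_ne fun e => hj ⟨t, e.symm⟩]
    · ext k
      rw [h, Function.comp_apply]
      by_cases hk : k = t
      · subst hk; simp
      · rw [Function.update_of_ne hk, Function.update_of_ne (hf.ne hk), Function.comp_apply]
    · ext j
      by_cases hr : j ∈ Set.range f
      · obtain ⟨k, rfl⟩ := hr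
        have := congrFun h2 k
        rw [Function.comp_apply] at this
        rw [this]
        by_cases hk : k = t
        · subst hk; simp
        · rw [Function.update_of_ne hk, Function.update_of_ne (hf.ne hk), Function.comp_apply]
      · rw [h1 j hr, Function.update_of_ne fun e => hr ⟨t, e.symm⟩]

/-- Relabelling a circuit: `E` is the induced embedding of matrix algebras. -/
theorem Implements.map {m : ℕ} {W : Matrix (Bits κ) (Bits κ) ℂ} (h : Implements m W)
    (f : κ → ι) (hf : Function.Injective f)
    (E : Matrix (Bits κ) (Bits κ) ℂ → Matrix (Bits ι) (Bits ι) ℂ) (h1 : E 1 = 1)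
    (hmul : ∀ A B, E (A * B) = E A * E B) (hE : ∀ g : Gate κ, (g.map f hf).matrix = E g.matrix) :
    Implements m (E W) := by
  obtain ⟨C, rfl, rfl⟩ := h
  refine ⟨C.map (Gate.map f hf), ?_, ?_⟩
  · induction C with
    | nil => exact h1.symm
    | cons g C ih =>
      change Circuit.matrix (List.map (Gate.map f hf) C) * (g.map f hf).matrix
        = E (Circuit.matrix C * g.matrix)
      rw [ih, hE, hmul]
  · rw [Circuit.cnotCount, List.countP_map]
    exact congrArg (fun p => List.countP p C) (funext fun g => Gate.isCNOT_map f hf g)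

/-- Relabelling of basis states along a bijection of the qubits. -/
def bitsCongr (e : κ ≃ ι) : Bits ι ≃ Bits κ where
  toFun x := x ∘ e
  invFun y := y ∘ e.symm
  left_inv x := by ext j; simp
  right_inv y := by ext j; simp

theorem Implements.congr {m : ℕ} {W : Matrix (Bits κ) (Bits κ) ℂ} (h : Implements m W)
    (e : κ ≃ ι) : Implements m (W.submatrix (bitsCongr e) (bitsCongr e)) := by
  refine h.map e e.injective (fun W => W.submatrix (bitsCongr e) (bitsCongr e)) ?_ ?_ ?_
  · exact submatrix_one_equiv _
  · exact fun A B => (submatrix_mul_equiv A B _ _ _).symm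
  · intro g
    ext x y
    rw [Gate.matrix_map_apply, if_pos fun j hj => (hj (e.surjective j)).elim]
    rfl

end Map

section Top

variable (κ : Type*)

/-- Splitting the basis states of a register with a distinguished top qubit `none` according to the
value of that qubit, so that matrices become `2 × 2` block matrices. -/
def topSplit : Bits (Option κ) ≃ Bits κ ⊕ Bits κ where
  toFun x := if x none = 0 then Sum.inl (x ∘ some) else Sum.inr (x ∘ some)
  invFun := Sum.elim (fun y o => o.elim 0 y) (fun y o => o.elim 1 y)
  left_inv x := by
    ext o
    by_cases h : x none = 0
    · cases o <;> simp [h]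
    · have h1 : x none = 1 := by omega
      cases o <;> simp [h1]
  right_inv s := by
    rcases s with y | y <;> simp <;> rfl

variable {κ}

@[simp] theorem topSplit_symm_inl_none (y : Bits κ) : (topSplit κ).symm (Sum.inl y) none = 0 := rfl
@[simp] theorem topSplit_symm_inr_none (y : Bits κ) : (topSplit κ).symm (Sum.inr y) none = 1 := rfl
@[simp] theorem topSplit_symm_inl_some (y : Bits κ) (j : κ) :
    (topSplit κ).symm (Sum.inl y) (some j) = y j := rfl
@[simp] theorem topSplit_symm_inr_some (y : Bits κ) (j : κ) :
    (topSplit κ).symm (Sum.inr y) (some j) = y j := rfl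
@[simp] theorem topSplit_symm_inl_comp (y : Bits κ) :
    (topSplit κ).symm (Sum.inl y) ∘ some = y := rfl
@[simp] theorem topSplit_symm_inr_comp (y : Bits κ) :
    (topSplit κ).symm (Sum.inr y) ∘ some = y := rfl

variable [Fintype κ] [DecidableEq κ]

/-- A matrix on the lower qubits, extended by the identity on the top qubit. -/
def low (W : Matrix (Bits κ) (Bits κ) ℂ) : Matrix (Bits κ ⊕ Bits κ) (Bits κ ⊕ Bits κ) ℂ :=
  fromBlocks W 0 0 W

/-- A matrix on the top qubit, extended by the identity on the lower qubits. -/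
def topGate (κ : Type*) [DecidableEq κ] [Fintype κ] (U : Matrix (Fin 2) (Fin 2) ℂ) :
    Matrix (Bits κ ⊕ Bits κ) (Bits κ ⊕ Bits κ) ℂ :=
  fromBlocks (U 0 0 • 1) (U 0 1 • 1) (U 1 0 • 1) (U 1 1 • 1)

/-- The block matrix `X`, with blocks indexed by the value of the top qubit, is implemented by a
circuit with exactly `m` C-NOT gates. -/
def BlockImpl (m : ℕ) (X : Matrix (Bits κ ⊕ Bits κ) (Bits κ ⊕ Bits κ) ℂ) : Prop :=
  Implements m (X.submatrix (topSplit κ) (topSplit κ))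

theorem BlockImpl.of_eq {m : ℕ} {X : Matrix (Bits κ ⊕ Bits κ) (Bits κ ⊕ Bits κ) ℂ}
    {W : Matrix (Bits (Option κ)) (Bits (Option κ)) ℂ} (h : Implements m W)
    (hW : W.submatrix (topSplit κ).symm (topSplit κ).symm = X) : BlockImpl m X := by
  rw [BlockImpl, ← hW]
  simpa using h

theorem BlockImpl.mul {m m' : ℕ} {X X' : Matrix (Bits κ ⊕ Bits κ) (Bits κ ⊕ Bits κ) ℂ}
    (h : BlockImpl m X) (h' : BlockImpl m' X') : BlockImpl (m + m') (X * X') := by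
  rw [BlockImpl, ← submatrix_mul_equiv X X' _ (topSplit κ)]
  exact Implements.mul h h'

/-- A circuit on the lower qubits. -/
theorem BlockImpl.low {m : ℕ} {W : Matrix (Bits κ) (Bits κ) ℂ} (h : Implements m W) :
    BlockImpl m (low W) := by
  refine h.map some (Option.some_injective _)
    (fun W => (fromBlocks W 0 0 W).submatrix (topSplit κ) (topSplit κ)) ?_ ?_ ?_
  · rw [fromBlocks_one, submatrix_one_equiv]
  · intro A B
    rw [submatrix_mul_equiv, fromBlocks_multiply]
    simp
  · intro g
    ext x y
    obtain ⟨x, rfl⟩ := (topSplit κ).symm.surjective x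
    obtain ⟨y, rfl⟩ := (topSplit κ).symm.surjective y
    have h : ∀ x y : Bits (Option κ), (∀ j ∉ Set.range some, x j = y j) ↔ x none = y none := by
      intro x y
      refine ⟨fun h => h _ (by simp), fun h j hj => ?_⟩
      cases j with
      | none => exact h
      | some k => exact (hj ⟨k, rfl⟩).elim
    rw [Gate.matrix_map_apply, submatrix_apply, Equiv.apply_symm_apply, Equiv.apply_symm_apply]
    simp only [h]
    rcases x with x | x <;> rcases y with y | y <;> simp

/-- A single-qubit gate on the top qubit. -/
theorem BlockImpl.topGate {U : Matrix (Fin 2) (Fin 2) ℂ} (hU : U ∈ unitaryGroup (Fin 2) ℂ) :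
    BlockImpl 0 (topGate κ U) := by
  refine BlockImpl.of_eq (Implements.single none ⟨U, hU⟩) ?_
  have h : ∀ x y : Bits (Option κ), (∀ j, j ≠ none → x j = y j) ↔ x ∘ some = y ∘ some := by
    intro x y
    refine ⟨fun h => funext fun j => h _ (by simp), fun h j hj => ?_⟩
    obtain ⟨k, rfl⟩ := Option.ne_none_iff_exists'.1 hj
    exact congrFun h k
  ext x y
  simp only [submatrix_apply, Gate.matrix, of_apply, h, StatePrep.topGate]
  rcases x with x | x <;> rcases y with y | y <;> by_cases hxy : x = y <;> simp [one_apply, hxy]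

/-- The projection onto the basis states in which the bit `j` equals `b`. -/
def bitProj (j : κ) (b : Fin 2) : Matrix (Bits κ) (Bits κ) ℂ :=
  diagonal fun y => if y j = b then 1 else 0

/-- The block matrix of the C-NOT from the lower qubit `j` to the top qubit. -/
def cnotTop (j : κ) : Matrix (Bits κ ⊕ Bits κ) (Bits κ ⊕ Bits κ) ℂ :=
  fromBlocks (bitProj j 0) (bitProj j 1) (bitProj j 1) (bitProj j 0)

theorem BlockImpl.cnotTop (j : κ) : BlockImpl 1 (cnotTop j) := by
  refine BlockImpl.of_eq (Implements.cnot (some j) none (by simp)) ?_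
  have h : ∀ x y : Bits (Option κ), x = Function.update y none (y none + y (some j)) ↔
      x none = y none + y (some j) ∧ x ∘ some = y ∘ some := by
    intro x y
    constructor
    · rintro rfl
      refine ⟨by simp, funext fun k => by simp⟩
    · rintro ⟨h1, h2⟩
      ext1 o
      cases o with
      | none => simpa using h1
      | some k => simpa using congrFun h2 k
  ext x y
  simp only [submatrix_apply, Gate.matrix, of_apply, h]
  rcases x with x | x <;> rcases y with y | y <;>
    simp only [topSplit_symm_inl_none, topSplit_symm_inr_none, topSplit_symm_inl_some,
      topSplit_symm_inr_some, topSplit_symm_inl_comp, topSplit_symm_inr_comp, StatePrep.cnotTop,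
      bitProj, fromBlocks_apply₁₁, fromBlocks_apply₁₂, fromBlocks_apply₂₁, fromBlocks_apply₂₂,
      diagonal_apply] <;>
    by_cases hxy : x = y <;> simp only [hxy, and_true, and_false, if_true, if_false]
  all_goals
    generalize y j = b
    fin_cases b <;> simp

end Top

/-! ### Multiplexed rotations -/

variable {κ : Type*} [Fintype κ] [DecidableEq κ]

/-- The `z`-rotation of the top qubit multiplexed by all lower qubits. -/
noncomputable def multRz (θ : Bits κ → ℝ) : Matrix (Bits κ ⊕ Bits κ) (Bits κ ⊕ Bits κ) ℂ :=
  fromBlocks (diagonal fun y => Complex.exp (θ y * Complex.I)) 0 0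
    (diagonal fun y => Complex.exp (-(θ y) * Complex.I))

/-- The Pauli `Z` on the qubit `j`. -/
def pauliZ (j : κ) : Matrix (Bits κ) (Bits κ) ℂ := diagonal fun y => if y j = 0 then 1 else -1

theorem low_mul_low (A B : Matrix (Bits κ) (Bits κ) ℂ) : low A * low B = low (A * B) := by
  simp [low, fromBlocks_multiply]

theorem topGate_mul_topGate (A B : Matrix (Fin 2) (Fin 2) ℂ) :
    topGate κ A * topGate κ B = topGate κ (A * B) := by
  simp only [topGate, fromBlocks_multiply, Matrix.smul_mul, Matrix.mul_smul, Matrix.one_mul,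
    smul_smul, ← add_smul, mul_apply, Fin.sum_univ_two]
  simp only [mul_comm]

theorem topGate_one : topGate κ 1 = 1 := by
  simp [topGate]

theorem commute_low_topGate (W : Matrix (Bits κ) (Bits κ) ℂ) (U : Matrix (Fin 2) (Fin 2) ℂ) :
    Commute (low W) (topGate κ U) := by
  simp [Commute, SemiconjBy, low, topGate, fromBlocks_multiply]

theorem commute_low_diagonal_cnotTop (d : Bits κ → ℂ) (j : κ) :
    Commute (low (diagonal d)) (cnotTop j) := by
  simp only [Commute, SemiconjBy, low, cnotTop, bitProj, fromBlocks_multiply, Matrix.zero_mul,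
    Matrix.mul_zero, add_zero, zero_add]
  simp only [diagonal_mul_diagonal, mul_comm]

theorem commute_low_diagonal_multRz (d : Bits κ → ℂ) (θ : Bits κ → ℝ) :
    Commute (low (diagonal d)) (multRz θ) := by
  simp only [Commute, SemiconjBy, low, multRz, fromBlocks_multiply, Matrix.zero_mul,
    Matrix.mul_zero, add_zero, zero_add]
  simp only [diagonal_mul_diagonal, mul_comm]

theorem cnotTop_mul_self (j : κ) : cnotTop j * cnotTop j = 1 := by
  simp only [cnotTop, bitProj, fromBlocks_multiply, diagonal_mul_diagonal, diagonal_add]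
  rw [← fromBlocks_one, fromBlocks_inj, ← diagonal_one, ← diagonal_zero]
  refine ⟨?_, ?_, ?_, ?_⟩ <;> congr 1 <;> ext y <;> generalize y j = b <;>
    fin_cases b <;> simp

theorem cnotTop_comm (j k : κ) : cnotTop j * cnotTop k = cnotTop k * cnotTop j := by
  simp only [cnotTop, bitProj, fromBlocks_multiply, diagonal_mul_diagonal, diagonal_add]
  rw [fromBlocks_inj]
  refine ⟨?_, ?_, ?_, ?_⟩ <;> congr 1 <;> ext y <;> ring

theorem multRz_mul_multRz (θ θ' : Bits κ → ℝ) : multRz θ * multRz θ' = multRz (θ + θ') := by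
  simp only [multRz, fromBlocks_multiply, diagonal_mul_diagonal, Matrix.zero_mul, Matrix.mul_zero,
    add_zero, zero_add, ← Complex.exp_add]
  congr 2 <;> ext y <;> congr 1 <;> simp <;> ring

/-- Commuting a C-NOT through a multiplexed rotation flips the angles where the control is set. -/
theorem cnotTop_mul_multRz (j : κ) (θ : Bits κ → ℝ) :
    cnotTop j * multRz θ = multRz (fun y => if y j = 0 then θ y else -θ y) * cnotTop j := by
  simp only [cnotTop, bitProj, multRz, fromBlocks_multiply, diagonal_mul_diagonal,
    Matrix.zero_mul, Matrix.mul_zero, add_zero, zero_add]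
  rw [fromBlocks_inj]
  refine ⟨?_, ?_, ?_, ?_⟩ <;> congr 1 <;> ext y <;> generalize y j = b <;>
    fin_cases b <;> simp

/-- `C-NOT` is `CZ` conjugated by Hadamard gates on the target. -/
theorem cnotTop_eq (j : κ) : cnotTop j = topGate κ TwoQubit.hadamard *
    fromBlocks 1 0 0 (pauliZ j) * topGate κ TwoQubit.hadamard := by
  have h := TwoQubit.sqrt_two_inv_mul_self
  rw [← diagonal_one, pauliZ, topGate, TwoQubit.hadamard]
  generalize (1 / (√2 : ℝ) : ℂ) = c at h
  simp only [cnotTop, bitProj, fromBlocks_multiply, ← diagonal_one, ← diagonal_smul,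
    diagonal_mul_diagonal, Matrix.mul_zero, add_zero, zero_add, diagonal_add]
  rw [fromBlocks_inj]
  refine ⟨?_, ?_, ?_, ?_⟩ <;> congr 1 <;> ext y <;> simp <;> generalize y j = b <;>
    fin_cases b <;> simp [h] <;> norm_num

theorem BlockImpl.multRz_const (a : ℝ) : BlockImpl 0 (multRz (κ := κ) fun _ => a) := by
  have h : multRz (κ := κ) (fun _ => a) = StatePrep.topGate κ
      (diagonal ![Complex.exp (a * Complex.I), Complex.exp (-a * Complex.I)]) := by
    simp [multRz, StatePrep.topGate, smul_one_eq_diagonal]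
  rw [h]
  refine BlockImpl.topGate (diagonal_mem_unitaryGroup fun i => ?_)
  fin_cases i
  · exact Complex.norm_exp_ofReal_mul_I a
  · simpa using Complex.norm_exp_ofReal_mul_I (-a)

/-- Splitting a multiplexed rotation into two that do not depend on the control `j`: half the sum
and half the difference of the angles for the two values of the bit `j`. -/
theorem multRz_mul_cnotTop_eq (j : κ) (θ : Bits κ → ℝ) :
    multRz θ * cnotTop j =
      multRz (fun y => (θ (Function.update y j 0) + θ (Function.update y j 1)) / 2) * cnotTop j *
        multRz (fun y => (θ (Function.update y j 0) - θ (Function.update y j 1)) / 2) := by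
  rw [Matrix.mul_assoc, cnotTop_mul_multRz, ← Matrix.mul_assoc, multRz_mul_multRz]
  congr 2
  ext y
  have h : θ y = θ (Function.update y j (y j)) := by rw [Function.update_eq_self]
  rw [h]
  simp only [Pi.add_apply]
  generalize y j = b
  fin_cases b <;> simp <;> ring

/-- A rotation multiplexed by `s + 1` qubits costs `2 ^ (s + 1)` C-NOTs, the last of which is the
C-NOT controlled by a prescribed one of these qubits. -/
theorem BlockImpl.multRz_mul_cnotTop_of_dependsOn (S : Finset κ) :
    ∀ j ∉ S, ∀ θ : Bits κ → ℝ, (∀ x y, (∀ i ∈ insert j S, x i = y i) → θ x = θ y) →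
      BlockImpl (2 ^ (S.card + 1) - 1) (multRz θ * StatePrep.cnotTop j) := by
  induction S using Finset.induction_on with
  | empty =>
    intro j _ θ hθ
    have hc : ∀ b, (fun y => θ (Function.update y j b)) = fun _ => θ (Function.update 0 j b) := by
      intro b
      ext y
      refine hθ _ _ fun i hi => ?_
      rw [Finset.mem_insert, or_iff_left (Finset.notMem_empty i)] at hi
      subst hi
      simp
    have h0 := congrFun (hc 0)
    have h1 := congrFun (hc 1)
    rw [multRz_mul_cnotTop_eq]
    simp only [h0, h1]
    simpa using ((BlockImpl.multRz_const _).mul (BlockImpl.cnotTop j)).mul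
      (BlockImpl.multRz_const _)
  | insert k S hk ih =>
    intro j hj θ hθ
    rw [Finset.mem_insert, not_or] at hj
    have hupd : ∀ b x y, (∀ i ∈ insert k S, x i = y i) →
        θ (Function.update x j b) = θ (Function.update y j b) := by
      intro b x y hxy
      refine hθ _ _ fun i hi => ?_
      by_cases hij : i = j
      · subst hij; simp
      · rw [Function.update_of_ne hij, Function.update_of_ne hij]
        exact hxy i ((Finset.mem_insert.1 hi).resolve_left hij)
    rw [multRz_mul_cnotTop_eq]
    set α : Bits κ → ℝ := fun y => (θ (Function.update y j 0) + θ (Function.update y j 1)) / 2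
    set β : Bits κ → ℝ := fun y => (θ (Function.update y j 0) - θ (Function.update y j 1)) / 2
    have hα := ih k hk α fun x y hxy => by simp only [α, hupd 0 x y hxy, hupd 1 x y hxy]
    have hβ := ih k hk (fun y => if y k = 0 then β y else -β y) fun x y hxy => by
      simp only [β, hupd 0 x y hxy, hupd 1 x y hxy, hxy k (Finset.mem_insert_self _ _)]
    rw [← cnotTop_mul_multRz] at hβ
    have hcj : StatePrep.cnotTop k * (StatePrep.cnotTop j * StatePrep.cnotTop k)
        = StatePrep.cnotTop j := by
      rw [cnotTop_comm j k, ← Matrix.mul_assoc, cnotTop_mul_self, Matrix.one_mul]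
    have h := (hα.mul (BlockImpl.cnotTop j)).mul hβ
    rw [show multRz α * StatePrep.cnotTop k * StatePrep.cnotTop j
        * (StatePrep.cnotTop k * multRz β)
      = multRz α * (StatePrep.cnotTop k * (StatePrep.cnotTop j * StatePrep.cnotTop k))
        * multRz β by simp only [Matrix.mul_assoc], hcj] at h
    have hcard : 2 ^ (S.card + 1) - 1 + 1 + (2 ^ (S.card + 1) - 1)
        = 2 ^ ((insert k S).card + 1) - 1 := by
      rw [Finset.card_insert_of_notMem hk]
      have : 0 < 2 ^ (S.card + 1) := by positivity
      have h2 : 2 ^ (S.card + 1 + 1) = 2 * 2 ^ (S.card + 1) := by ring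
      omega
    rwa [hcard] at h

theorem BlockImpl.multRz_mul_cnotTop (j : κ) (θ : Bits κ → ℝ) :
    BlockImpl (2 ^ Fintype.card κ - 1) (multRz θ * StatePrep.cnotTop j) := by
  have h := BlockImpl.multRz_mul_cnotTop_of_dependsOn (Finset.univ.erase j) j (by simp) θ
    fun x y hxy => congrArg θ (funext fun i => hxy i (by simp))
  rwa [Finset.card_erase_add_one (Finset.mem_univ j), Finset.card_univ] at h

theorem BlockImpl.cnotTop_mul_multRz (j : κ) (θ : Bits κ → ℝ) :
    BlockImpl (2 ^ Fintype.card κ - 1) (StatePrep.cnotTop j * multRz θ) := by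
  rw [StatePrep.cnotTop_mul_multRz]
  exact BlockImpl.multRz_mul_cnotTop j _

theorem BlockImpl.multRz [Nonempty κ] (θ : Bits κ → ℝ) :
    BlockImpl (2 ^ Fintype.card κ) (multRz θ) := by
  obtain ⟨j⟩ := ‹Nonempty κ›
  have h := (BlockImpl.multRz_mul_cnotTop j θ).mul (BlockImpl.cnotTop j)
  rwa [Matrix.mul_assoc, cnotTop_mul_self, Matrix.mul_one, Nat.sub_add_cancel Nat.one_le_two_pow]
    at h

/-! ### Synthesis of unitaries and isometries -/

variable {κ : Type*} [Fintype κ] [DecidableEq κ]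

/-- Every unitary on the register `κ` is, up to a diagonal unitary on the input side, implemented
by a circuit with exactly `u` C-NOT gates. -/
def UpToDiagonal (κ : Type*) [Fintype κ] [DecidableEq κ] (u : ℕ) : Prop :=
  ∀ U ∈ unitaryGroup (Bits κ) ℂ, ∃ W, Implements u W ∧
    ∃ d : Bits κ → ℂ, (∀ x, ‖d x‖ = 1) ∧ U = W * diagonal d

/-- The block matrix `X` is implemented with exactly `m` C-NOT gates, up to a diagonal unitary on
the lower qubits on the input side. -/
def BlockImplUpToDiagonal (m : ℕ) (X : Matrix (Bits κ ⊕ Bits κ) (Bits κ ⊕ Bits κ) ℂ) : Prop :=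
  ∃ Y, BlockImpl m Y ∧ ∃ d : Bits κ → ℂ, (∀ x, ‖d x‖ = 1) ∧ X = Y * low (diagonal d)

namespace BlockImplUpToDiagonal

variable {m m' u : ℕ} {X Y : Matrix (Bits κ ⊕ Bits κ) (Bits κ ⊕ Bits κ) ℂ}

/-- The pending diagonal passes through a factor with which it commutes. -/
theorem mul_of_commute (hX : BlockImplUpToDiagonal m X) (hY : BlockImpl m' Y)
    (hc : ∀ d : Bits κ → ℂ, Commute (low (diagonal d)) Y) :
    BlockImplUpToDiagonal (m + m') (X * Y) := by
  obtain ⟨W, hW, d, hd, rfl⟩ := hX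
  exact ⟨W * Y, hW.mul hY, d, hd, by rw [Matrix.mul_assoc, (hc d).eq, Matrix.mul_assoc]⟩

/-- The pending diagonal is absorbed into the next unitary on the lower qubits, which leaves a new
one behind. -/
theorem mul_low (hu : UpToDiagonal κ u) (hX : BlockImplUpToDiagonal m X)
    {V : Matrix (Bits κ) (Bits κ) ℂ} (hV : V ∈ unitaryGroup (Bits κ) ℂ) :
    BlockImplUpToDiagonal (m + u) (X * low V) := by
  obtain ⟨W, hW, d, hd, rfl⟩ := hX
  obtain ⟨V', hV', d', hd', e⟩ := hu _ (mul_mem (diagonal_mem_unitaryGroup hd) hV)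
  exact ⟨W * low V', hW.mul (BlockImpl.low hV'), d', hd', by
    rw [Matrix.mul_assoc, low_mul_low, e, ← low_mul_low, Matrix.mul_assoc]⟩

theorem low (hu : UpToDiagonal κ u) {V : Matrix (Bits κ) (Bits κ) ℂ}
    (hV : V ∈ unitaryGroup (Bits κ) ℂ) : BlockImplUpToDiagonal u (low V) := by
  obtain ⟨V', hV', d', hd', e⟩ := hu _ hV
  exact ⟨_, BlockImpl.low hV', d', hd', by rw [low_mul_low, e]⟩

end BlockImplUpToDiagonal

theorem commute_low_topGate_hadamard (d : Bits κ → ℂ) :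
    Commute (low (diagonal d)) (topGate κ TwoQubit.hadamard) := commute_low_topGate _ _

theorem topGate_hadamard_mul_self :
    topGate κ TwoQubit.hadamard * topGate κ TwoQubit.hadamard = 1 := by
  rw [topGate_mul_topGate, TwoQubit.hadamard_mul_hadamard, topGate_one]

theorem smul_mem_unitaryGroup_of_norm {c : ℂ} (hc : ‖c‖ = 1) {V : Matrix (Bits κ) (Bits κ) ℂ}
    (hV : V ∈ unitaryGroup (Bits κ) ℂ) : c • V ∈ unitaryGroup (Bits κ) ℂ := by
  rw [show c • V = diagonal (fun _ => c) * V by rw [← smul_one_eq_diagonal]; simp]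
  exact mul_mem (diagonal_mem_unitaryGroup fun _ => hc) hV

theorem exp_diagonal_mem (θ : Bits κ → ℝ) :
    diagonal (fun y => Complex.exp (θ y * Complex.I)) ∈ unitaryGroup (Bits κ) ℂ :=
  diagonal_mem_unitaryGroup fun y => Complex.norm_exp_ofReal_mul_I (θ y)

theorem exp_neg_diagonal_mem (θ : Bits κ → ℝ) :
    diagonal (fun y => Complex.exp (-(θ y) * Complex.I)) ∈ unitaryGroup (Bits κ) ℂ := by
  simpa using exp_diagonal_mem fun y => -θ y

theorem pauliZ_mem (j : κ) : pauliZ j ∈ unitaryGroup (Bits κ) ℂ :=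
  diagonal_mem_unitaryGroup fun y => by split_ifs <;> simp

/-- The cosine-sine matrix is a multiplexed `z`-rotation conjugated by single-qubit gates on the
top qubit, the outer ones being phase gates that can be absorbed into the neighbours. -/
theorem cosineSine_eq (θ : Bits κ → ℝ) :
    fromBlocks (diagonal fun i => (Real.cos (θ i) : ℂ)) (diagonal fun i => -(Real.sin (θ i) : ℂ))
      (diagonal fun i => (Real.sin (θ i) : ℂ)) (diagonal fun i => (Real.cos (θ i) : ℂ))
    = fromBlocks 1 0 0 (Complex.I • 1) * (topGate κ TwoQubit.hadamard * multRz (-θ) *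
        topGate κ TwoQubit.hadamard) * fromBlocks 1 0 0 (-Complex.I • 1) := by
  have h := TwoQubit.sqrt_two_inv_mul_self
  rw [← diagonal_one, topGate, multRz, TwoQubit.hadamard]
  generalize (1 / (√2 : ℝ) : ℂ) = c at h
  simp only [fromBlocks_multiply, ← diagonal_one, ← diagonal_smul,
    diagonal_mul_diagonal, Matrix.zero_mul, Matrix.mul_zero, add_zero, zero_add, diagonal_add]
  have hI := Complex.I_mul_I
  rw [fromBlocks_inj]
  refine ⟨?_, ?_, ?_, ?_⟩ <;> congr 1 <;> ext y <;>
    simp [Complex.cos, Complex.sin] <;>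
    generalize Complex.exp (θ y * Complex.I) = e <;>
    generalize Complex.exp (-(θ y * Complex.I)) = e'
  · linear_combination (-(e + e')) * h
  · linear_combination (-Complex.I * (e' - e)) * h
  · linear_combination (-Complex.I * (e' - e)) * h
  · linear_combination (-(e + e')) * h + (c * c * (e + e')) * hI

/-- A multiplexor of two unitaries costs two unitaries on the lower qubits and a multiplexed
rotation. -/
theorem exists_multiplexor_eq {A B : Matrix (Bits κ) (Bits κ) ℂ}
    (hA : A ∈ unitaryGroup (Bits κ) ℂ) (hB : B ∈ unitaryGroup (Bits κ) ℂ) :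
    ∃ V ∈ unitaryGroup (Bits κ) ℂ, ∃ W ∈ unitaryGroup (Bits κ) ℂ, ∃ θ,
      fromBlocks A 0 0 B = low V * multRz θ * low W := by
  obtain ⟨V, hV, W, hW, θ, eA, eB⟩ := exists_demultiplex hA hB
  refine ⟨V, hV, W, hW, θ, ?_⟩
  simp only [low, multRz, fromBlocks_multiply, Matrix.zero_mul, Matrix.mul_zero, add_zero, zero_add]
  rw [eA, eB]

/-- One step of the block-ZXZ recursion. The C-NOTs that end the outer two multiplexed rotations
are moved through the Hadamard gates and absorbed, as `CZ` gates, into the central multiplexor. -/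
theorem blockImplUpToDiagonal_of_mem_unitaryGroup [Nonempty κ] {u : ℕ} (hu : UpToDiagonal κ u)
    {X : Matrix (Bits κ ⊕ Bits κ) (Bits κ ⊕ Bits κ) ℂ}
    (hX : X ∈ unitaryGroup (Bits κ ⊕ Bits κ) ℂ) :
    BlockImplUpToDiagonal (4 * u + 3 * 2 ^ Fintype.card κ - 2) X := by
  obtain ⟨j⟩ := id ‹Nonempty κ›
  obtain ⟨L₀, hL₀, L₁, hL₁, R₀, hR₀, R₁, hR₁, θ, rfl⟩ := exists_cosineSine hX
  obtain ⟨VA, hVA, WA, hWA, α, eA⟩ :=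
    exists_multiplexor_eq hL₀ (smul_mem_unitaryGroup_of_norm (c := Complex.I) (by simp) hL₁)
  obtain ⟨VC, hVC, WC, hWC, γ, eC⟩ :=
    exists_multiplexor_eq hR₀ (smul_mem_unitaryGroup_of_norm (c := -Complex.I) (by simp) hR₁)
  obtain ⟨V, hV, W, hW, β, eB⟩ := exists_multiplexor_eq
    (mul_mem (mul_mem hWA (exp_diagonal_mem (-θ))) hVC)
    (mul_mem (mul_mem (mul_mem (pauliZ_mem j) (mul_mem hWA (exp_neg_diagonal_mem (-θ)))) hVC)
      (pauliZ_mem j))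
  set h := topGate κ TwoQubit.hadamard with hh
  set Z : Matrix (Bits κ ⊕ Bits κ) (Bits κ ⊕ Bits κ) ℂ := fromBlocks 1 0 0 (pauliZ j) with hZ
  have hhh : h * h = 1 := topGate_hadamard_mul_self
  have hAh : low WA * h = h * low WA := commute_low_topGate _ _
  have hCh : h * low VC = low VC * h := (commute_low_topGate _ _).eq.symm
  have hmid : Z * low WA * multRz (-θ) * low VC * Z = low V * multRz β * low W := by
    rw [← eB]
    simp [hZ, low, multRz, fromBlocks_multiply, Matrix.mul_assoc, -fromBlocks_diagonal]
  have hCC := cnotTop_mul_self j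
  have hcz : cnotTop j = h * Z * h := cnotTop_eq j
  have hcz' : cnotTop j * h = h * Z := by rw [hcz, Matrix.mul_assoc, hhh, Matrix.mul_one]
  have hcz'' : h * cnotTop j = Z * h := by
    rw [hcz, ← Matrix.mul_assoc, ← Matrix.mul_assoc, hhh, Matrix.one_mul]
  have key : fromBlocks L₀ 0 0 L₁ * fromBlocks (diagonal fun i => (Real.cos (θ i) : ℂ))
        (diagonal fun i => -(Real.sin (θ i) : ℂ)) (diagonal fun i => (Real.sin (θ i) : ℂ))
        (diagonal fun i => (Real.cos (θ i) : ℂ)) * fromBlocks R₀ 0 0 R₁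
      = low VA * (multRz α * cnotTop j) * h * low V * multRz β * low W * h
          * (cnotTop j * multRz γ) * low WC := by
    calc _ = (fromBlocks L₀ 0 0 L₁ * fromBlocks 1 0 0 (Complex.I • 1)) * (h * multRz (-θ) * h)
          * (fromBlocks 1 0 0 (-Complex.I • 1) * fromBlocks R₀ 0 0 R₁) := by
          rw [cosineSine_eq, ← hh]; simp only [Matrix.mul_assoc]
      _ = (low VA * multRz α * low WA) * (h * multRz (-θ) * h)
          * (low VC * multRz γ * low WC) := by
          rw [← eA, ← eC]
          simp [fromBlocks_multiply]
      _ = low VA * multRz α * ((cnotTop j * cnotTop j) * (low WA * h) * multRz (-θ) * (h * low VC)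
          * (cnotTop j * cnotTop j)) * multRz γ * low WC := by
          rw [hCC, Matrix.one_mul, Matrix.mul_one]; simp only [Matrix.mul_assoc]
      _ = low VA * (multRz α * cnotTop j) * ((cnotTop j * h) * low WA * multRz (-θ) * low VC
          * (h * cnotTop j)) * (cnotTop j * multRz γ) * low WC := by
          rw [hAh, hCh]; simp only [Matrix.mul_assoc]
      _ = low VA * (multRz α * cnotTop j) * (h * (Z * low WA * multRz (-θ) * low VC * Z) * h)
          * (cnotTop j * multRz γ) * low WC := by
          rw [hcz', hcz'']; simp only [Matrix.mul_assoc]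
      _ = _ := by
          rw [hmid]; simp only [Matrix.mul_assoc]
  rw [key]
  have hH : BlockImpl 0 h := BlockImpl.topGate TwoQubit.hadamard_mem
  have hHc := commute_low_topGate_hadamard (κ := κ)
  have := ((((((((BlockImplUpToDiagonal.low hu hVA).mul_of_commute
    (BlockImpl.multRz_mul_cnotTop j α) fun d =>
      (commute_low_diagonal_multRz d _).mul_right (commute_low_diagonal_cnotTop d j)).mul_of_commute
    hH hHc).mul_low hu hV).mul_of_commute (BlockImpl.multRz β) fun d =>
      commute_low_diagonal_multRz d _).mul_low hu hW).mul_of_commute hH hHc).mul_of_commute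
    (BlockImpl.cnotTop_mul_multRz j γ) fun d =>
      (commute_low_diagonal_cnotTop d j).mul_right (commute_low_diagonal_multRz d _)).mul_low hu hWC
  have hpos : 0 < 2 ^ Fintype.card κ := by positivity
  convert this using 1
  omega

/-- The first block column of a unitary, an isometry that adjoins a qubit, needs only three
unitaries on the lower qubits. -/
theorem exists_blockImplUpToDiagonal_column [Nonempty κ] {u : ℕ} (hu : UpToDiagonal κ u)
    {X : Matrix (Bits κ ⊕ Bits κ) (Bits κ ⊕ Bits κ) ℂ}
    (hX : X ∈ unitaryGroup (Bits κ ⊕ Bits κ) ℂ) :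
    ∃ Y, BlockImplUpToDiagonal (3 * u + 2 * 2 ^ Fintype.card κ - 1) Y ∧
      X * fromBlocks 1 0 0 0 = Y * fromBlocks 1 0 0 0 := by
  obtain ⟨j⟩ := id ‹Nonempty κ›
  obtain ⟨L₀, hL₀, L₁, hL₁, R₀, hR₀, R₁, hR₁, θ, rfl⟩ := exists_cosineSine hX
  obtain ⟨V, hV, W, hW, α, eA⟩ :=
    exists_multiplexor_eq hL₀
      (mul_mem (smul_mem_unitaryGroup_of_norm (c := Complex.I) (by simp) hL₁) (pauliZ_mem j))
  set h := topGate κ TwoQubit.hadamard with hh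
  set Z : Matrix (Bits κ ⊕ Bits κ) (Bits κ ⊕ Bits κ) ℂ := fromBlocks 1 0 0 (pauliZ j) with hZ
  have hhh : h * h = 1 := topGate_hadamard_mul_self
  have hCC := cnotTop_mul_self j
  have hcz : h * cnotTop j = Z * h := by
    rw [cnotTop_eq j, ← Matrix.mul_assoc, ← Matrix.mul_assoc, hhh, Matrix.one_mul]
  refine ⟨low V * multRz α * low W * h * (cnotTop j * multRz (-θ)) * h * low R₀, ?_, ?_⟩
  · have hH : BlockImpl 0 h := BlockImpl.topGate TwoQubit.hadamard_mem
    have hHc := commute_low_topGate_hadamard (κ := κ)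
    have := ((((((BlockImplUpToDiagonal.low hu hV).mul_of_commute (BlockImpl.multRz α) fun d =>
      commute_low_diagonal_multRz d _).mul_low hu hW).mul_of_commute hH hHc).mul_of_commute
      (BlockImpl.cnotTop_mul_multRz j (-θ)) fun d =>
        (commute_low_diagonal_cnotTop d j).mul_right
          (commute_low_diagonal_multRz d _)).mul_of_commute hH hHc).mul_low hu hR₀
    have hpos : 0 < 2 ^ Fintype.card κ := by positivity
    convert this using 1
    omega
  · have hR : fromBlocks 1 0 0 (-Complex.I • 1) * (fromBlocks R₀ 0 0 R₁ * fromBlocks 1 0 0 0)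
        = low R₀ * fromBlocks 1 0 0 0 := by
      simp [low, fromBlocks_multiply]
    calc _ = (fromBlocks L₀ 0 0 L₁ * fromBlocks 1 0 0 (Complex.I • 1)) * (h * multRz (-θ) * h)
          * (fromBlocks 1 0 0 (-Complex.I • 1) * (fromBlocks R₀ 0 0 R₁ * fromBlocks 1 0 0 0)) := by
          rw [cosineSine_eq, ← hh]; simp only [Matrix.mul_assoc]
      _ = (fromBlocks L₀ 0 0 L₁ * fromBlocks 1 0 0 (Complex.I • 1)) * ((h * cnotTop j)
          * (cnotTop j * multRz (-θ)) * h) * (low R₀ * fromBlocks 1 0 0 0) := by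
          rw [hR, show h * cnotTop j * (cnotTop j * multRz (-θ)) * h
            = h * ((cnotTop j * cnotTop j) * multRz (-θ)) * h by simp only [Matrix.mul_assoc], hCC,
            Matrix.one_mul]
      _ = (fromBlocks L₀ 0 0 L₁ * fromBlocks 1 0 0 (Complex.I • 1) * Z) * h
          * (cnotTop j * multRz (-θ)) * h * low R₀ * fromBlocks 1 0 0 0 := by
          rw [hcz]; simp only [Matrix.mul_assoc]
      _ = _ := by
          rw [← eA]
          simp [fromBlocks_multiply, hZ]

theorem UpToDiagonal.congr {κ ι : Type*} [Fintype κ] [DecidableEq κ] [Fintype ι] [DecidableEq ι]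
    {u : ℕ} (h : UpToDiagonal κ u) (e : κ ≃ ι) : UpToDiagonal ι u := by
  intro U hU
  obtain ⟨W, hW, d, hd, he⟩ := h _ (submatrix_mem_unitaryGroup hU (bitsCongr e).symm)
  refine ⟨_, hW.congr e, d ∘ bitsCongr e, fun x => hd _, ?_⟩
  have h2 := congrArg (fun X => X.submatrix (bitsCongr e) (bitsCongr e)) he
  simp only [submatrix_submatrix, Equiv.symm_comp_self, submatrix_id_id] at h2
  rw [h2, ← submatrix_mul_equiv _ _ _ (bitsCongr e), submatrix_diagonal_equiv]

theorem UpToDiagonal.option {κ : Type*} [Fintype κ] [DecidableEq κ] [Nonempty κ] {u : ℕ}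
    (h : UpToDiagonal κ u) : UpToDiagonal (Option κ) (4 * u + 3 * 2 ^ Fintype.card κ - 2) := by
  intro U hU
  obtain ⟨Y, hY, d, hd, he⟩ := blockImplUpToDiagonal_of_mem_unitaryGroup h
    (submatrix_mem_unitaryGroup hU (topSplit κ).symm)
  refine ⟨_, hY, Sum.elim d d ∘ topSplit κ, fun x => ?_, ?_⟩
  · rw [Function.comp_apply]
    rcases topSplit κ x with y | y <;> exact hd y
  · have h2 := congrArg (fun X => X.submatrix (topSplit κ) (topSplit κ)) he
    simp only [submatrix_submatrix, Equiv.symm_comp_self, submatrix_id_id] at h2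
    rw [h2, low, fromBlocks_diagonal, ← submatrix_mul_equiv _ _ _ (topSplit κ),
      submatrix_diagonal_equiv]

/-- A one-qubit unitary is a single gate. -/
theorem upToDiagonal_one : UpToDiagonal (Fin 1) 0 := by
  intro U hU
  have hU' := submatrix_mem_unitaryGroup hU (Equiv.funUnique (Fin 1) (Fin 2)).symm
  refine ⟨_, Implements.single 0 ⟨_, hU'⟩, 1, fun _ => by simp, ?_⟩
  rw [show diagonal (1 : Bits (Fin 1) → ℂ) = 1 from diagonal_one, Matrix.mul_one]
  ext x y
  simp only [Gate.matrix, of_apply, submatrix_apply]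
  rw [if_pos fun j hj => (hj (Subsingleton.elim j 0)).elim]
  congr 1 <;> ext j <;> rw [Subsingleton.elim j 0] <;> rfl

/-- The basis states of two qubits as pairs of bits. -/
abbrev twoBits : Bits (Fin 2) ≃ Fin 2 × Fin 2 := finTwoArrowEquiv (Fin 2)

theorem implements_local {a b : Matrix (Fin 2) (Fin 2) ℂ} (ha : a ∈ unitaryGroup (Fin 2) ℂ)
    (hb : b ∈ unitaryGroup (Fin 2) ℂ) : Implements 0 ((a ⊗ₖ b).submatrix twoBits twoBits) := by
  have h := (Implements.single (0 : Fin 2) ⟨a, ha⟩).mul (Implements.single (1 : Fin 2) ⟨b, hb⟩)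
  have e0 : (Gate.single (0 : Fin 2) ⟨a, ha⟩).matrix
      = (a ⊗ₖ (1 : Matrix (Fin 2) (Fin 2) ℂ)).submatrix twoBits twoBits := by
    ext x y
    simp [Gate.matrix, one_apply, Fin.forall_fin_two]
  have e1 : (Gate.single (1 : Fin 2) ⟨b, hb⟩).matrix
      = ((1 : Matrix (Fin 2) (Fin 2) ℂ) ⊗ₖ b).submatrix twoBits twoBits := by
    ext x y
    simp [Gate.matrix, one_apply, Fin.forall_fin_two]
  rwa [e0, e1, submatrix_mul_equiv, ← mul_kronecker_mul, Matrix.mul_one, Matrix.one_mul] at h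

theorem implements_cnotMatrix : Implements 1 (TwoQubit.cnotMatrix.submatrix twoBits twoBits) := by
  have h := Implements.cnot (0 : Fin 2) 1 (by decide)
  have e : (Gate.cnot (0 : Fin 2) 1 (by decide)).matrix
      = TwoQubit.cnotMatrix.submatrix twoBits twoBits := by
    ext x y
    simp [Gate.matrix, TwoQubit.cnotMatrix, funext_iff, Fin.forall_fin_two, Prod.ext_iff]
  rwa [e] at h

theorem upToDiagonal_two : UpToDiagonal (Fin 2) 2 := by
  intro U hU
  obtain ⟨a, ha, b, hb, c, hc, d, hd, e, he, f, hf, δ, hδ, hU'⟩ :=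
    TwoQubit.exists_two_cnot (submatrix_mem_unitaryGroup hU twoBits.symm)
  have hN := implements_cnotMatrix
  refine ⟨_, ((((implements_local ha hb).mul hN).mul (implements_local hc hd)).mul hN).mul
    (implements_local he hf), δ ∘ twoBits, fun x => hδ _, ?_⟩
  have h2 := congrArg (fun X => X.submatrix twoBits twoBits) hU'
  simp only [submatrix_submatrix, Equiv.symm_comp_self, submatrix_id_id] at h2
  rw [h2, ← submatrix_diagonal_equiv]
  simp only [submatrix_mul_equiv]

/-- The number of C-NOT gates used for a unitary on `k` qubits up to a diagonal. -/
def unitaryCount : ℕ → ℕ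
  | 0 => 0
  | 1 => 0
  | 2 => 2
  | k + 3 => 4 * unitaryCount (k + 2) + 3 * 2 ^ (k + 2) - 2

theorem upToDiagonal_fin (k : ℕ) : UpToDiagonal (Fin (k + 1)) (unitaryCount (k + 1)) := by
  match k with
  | 0 => exact upToDiagonal_one
  | 1 => exact upToDiagonal_two
  | k + 2 =>
    have h := (upToDiagonal_fin (k + 1)).option
    rw [Fintype.card_fin] at h
    exact h.congr (Fintype.equivOfCardEq (by simp))

theorem unitaryCount_closed_form (k : ℕ) :
    24 * unitaryCount (k + 2) + 36 * 2 ^ (k + 2) = 11 * 4 ^ (k + 2) + 16 := by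
  induction k with
  | zero => rfl
  | succ k ih =>
    have h : unitaryCount (k + 3) = 4 * unitaryCount (k + 2) + 3 * 2 ^ (k + 2) - 2 := rfl
    have hp : 1 ≤ 2 ^ (k + 2) := Nat.one_le_two_pow
    rw [show k + 1 + 2 = k + 3 from rfl, h, show k + 3 = k + 2 + 1 from rfl, pow_succ 2 (k + 2),
      pow_succ 4 (k + 2)]
    omega

/-- The first block column of every unitary on `Option κ` is implemented by a circuit with exactly
`v` C-NOT gates, up to a diagonal on `κ`. -/
def ColumnUpToDiagonal (κ : Type*) [Fintype κ] [DecidableEq κ] (v : ℕ) : Prop :=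
  ∀ X ∈ unitaryGroup (Bits κ ⊕ Bits κ) ℂ, ∃ Y, BlockImpl v Y ∧
    ∃ d : Bits κ → ℂ, (∀ x, ‖d x‖ = 1) ∧
      X * fromBlocks 1 0 0 0 = Y * fromBlocks (diagonal d) 0 0 0

theorem UpToDiagonal.column {κ : Type*} [Fintype κ] [DecidableEq κ] [Nonempty κ] {u : ℕ}
    (h : UpToDiagonal κ u) : ColumnUpToDiagonal κ (3 * u + 2 * 2 ^ Fintype.card κ - 1) := by
  intro X hX
  obtain ⟨_, ⟨Y, hY, d, hd, rfl⟩, he⟩ := exists_blockImplUpToDiagonal_column h hX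
  refine ⟨Y, hY, d, hd, ?_⟩
  rw [he, Matrix.mul_assoc]
  congr 1
  rw [low, fromBlocks_multiply]
  simp

theorem UpToDiagonal.column_of_option {κ : Type*} [Fintype κ] [DecidableEq κ] {v : ℕ}
    (h : UpToDiagonal (Option κ) v) : ColumnUpToDiagonal κ v := by
  intro X hX
  obtain ⟨W, hW, d, hd, he⟩ := h _ (submatrix_mem_unitaryGroup hX (topSplit κ))
  refine ⟨_, BlockImpl.of_eq hW rfl, d ∘ (topSplit κ).symm ∘ Sum.inl, fun x => hd _, ?_⟩
  have h2 := congrArg (fun X => X.submatrix (topSplit κ).symm (topSplit κ).symm) he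
  simp only [submatrix_submatrix, Equiv.self_comp_symm, submatrix_id_id] at h2
  rw [h2, ← submatrix_mul_equiv _ _ _ (topSplit κ).symm, Matrix.mul_assoc, submatrix_diagonal_equiv]
  congr 1
  have e : d ∘ (topSplit κ).symm
      = Sum.elim (d ∘ (topSplit κ).symm ∘ Sum.inl) (d ∘ (topSplit κ).symm ∘ Sum.inr) := by
    ext x; rcases x with x | x <;> rfl
  rw [e, ← fromBlocks_diagonal, fromBlocks_multiply]
  simp

/-! ### Preparation of states from their Schmidt decomposition -/

section States

/-- The state `ψ` is prepared by a circuit with exactly `m` C-NOT gates. -/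
def Preparable {ι : Type*} [Fintype ι] [DecidableEq ι] (m : ℕ) (ψ : Bits ι → ℂ) : Prop :=
  ∃ C : Circuit ι, C.Prepares ψ ∧ C.cnotCount = m

variable {ι κ κ' : Type*} [Fintype ι] [DecidableEq ι] [Fintype κ] [DecidableEq κ] [Fintype κ']
  [DecidableEq κ']

theorem preparable_iff {m : ℕ} {ψ : Bits ι → ℂ} :
    Preparable m ψ ↔ ∃ W, Implements m W ∧ W *ᵥ zeroKet ι = ψ := by
  constructor
  · rintro ⟨C, h, rfl⟩
    exact ⟨_, ⟨C, rfl, rfl⟩, h⟩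
  · rintro ⟨_, ⟨C, rfl, rfl⟩, h⟩
    exact ⟨C, h, rfl⟩

theorem Preparable.mulVec {m m' : ℕ} {ψ : Bits ι → ℂ} {W : Matrix (Bits ι) (Bits ι) ℂ}
    (h : Preparable m ψ) (hW : Implements m' W) : Preparable (m + m') (W *ᵥ ψ) := by
  rw [preparable_iff] at *
  obtain ⟨V, hV, rfl⟩ := h
  exact ⟨W * V, add_comm m m' ▸ hW.mul hV, (mulVec_mulVec _ _ _).symm⟩

theorem Preparable.congr {m : ℕ} {ψ : Bits κ → ℂ} (h : Preparable m ψ) (e : κ ≃ ι) :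
    Preparable m (ψ ∘ bitsCongr e) := by
  rw [preparable_iff] at *
  obtain ⟨W, hW, rfl⟩ := h
  refine ⟨_, hW.congr e, ?_⟩
  rw [submatrix_mulVec_equiv]
  congr 2
  ext x
  have hx : (bitsCongr e).symm x = 0 ↔ x = 0 := by
    rw [Equiv.symm_apply_eq]
    rfl
  simp [zeroKet, Pi.single_apply, hx]

/-- A state of two registers is a matrix; `MatPreparable m Ψ` says that the state with the matrix
`Ψ` of amplitudes is prepared with exactly `m` C-NOT gates. -/
def MatPreparable (m : ℕ) (Ψ : Matrix (Bits κ) (Bits κ') ℂ) : Prop :=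
  Preparable (ι := κ ⊕ κ') m fun z => Ψ (z ∘ Sum.inl) (z ∘ Sum.inr)

/-- Basis states of two registers as pairs. -/
def sumSplit (κ κ' : Type*) : Bits (κ ⊕ κ') ≃ Bits κ × Bits κ' :=
  Equiv.sumArrowEquivProdArrow κ κ' (Fin 2)

theorem Implements.sum_left {m : ℕ} {W : Matrix (Bits κ) (Bits κ) ℂ} (h : Implements m W) :
    Implements m ((W ⊗ₖ (1 : Matrix (Bits κ') (Bits κ') ℂ)).submatrix
      (sumSplit κ κ') (sumSplit κ κ')) := by
  refine h.map Sum.inl Sum.inl_injective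
    (fun W => (W ⊗ₖ (1 : Matrix (Bits κ') (Bits κ') ℂ)).submatrix
      (sumSplit κ κ') (sumSplit κ κ')) ?_ ?_ ?_
  · rw [one_kronecker_one, submatrix_one_equiv]
  · intro A B
    rw [submatrix_mul_equiv, ← mul_kronecker_mul, Matrix.one_mul]
  · intro g
    ext x y
    have h : (∀ j ∉ Set.range (Sum.inl : κ → κ ⊕ κ'), x j = y j) ↔
        x ∘ Sum.inr = y ∘ Sum.inr := by
      refine ⟨fun h => funext fun j => h _ (by simp), fun h j hj => ?_⟩
      rcases j with j | j
      · exact (hj ⟨j, rfl⟩).elim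
      · exact congrFun h j
    rw [Gate.matrix_map_apply]
    simp only [h, submatrix_apply, kroneckerMap_apply, one_apply]
    change _ = g.matrix (x ∘ Sum.inl) (y ∘ Sum.inl) * if x ∘ Sum.inr = y ∘ Sum.inr then 1 else 0
    by_cases hxy : x ∘ Sum.inr = y ∘ Sum.inr <;> simp [hxy]

theorem Implements.sum_right {m : ℕ} {W : Matrix (Bits κ') (Bits κ') ℂ} (h : Implements m W) :
    Implements m (((1 : Matrix (Bits κ) (Bits κ) ℂ) ⊗ₖ W).submatrix
      (sumSplit κ κ') (sumSplit κ κ')) := by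
  refine h.map Sum.inr Sum.inr_injective
    (fun W => ((1 : Matrix (Bits κ) (Bits κ) ℂ) ⊗ₖ W).submatrix
      (sumSplit κ κ') (sumSplit κ κ')) ?_ ?_ ?_
  · rw [one_kronecker_one, submatrix_one_equiv]
  · intro A B
    rw [submatrix_mul_equiv, ← mul_kronecker_mul, Matrix.one_mul]
  · intro g
    ext x y
    have h : (∀ j ∉ Set.range (Sum.inr : κ' → κ ⊕ κ'), x j = y j) ↔
        x ∘ Sum.inl = y ∘ Sum.inl := by
      refine ⟨fun h => funext fun j => h _ (by simp), fun h j hj => ?_⟩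
      rcases j with j | j
      · exact congrFun h j
      · exact (hj ⟨j, rfl⟩).elim
    rw [Gate.matrix_map_apply]
    simp only [h, submatrix_apply, kroneckerMap_apply, one_apply]
    change _ = (if x ∘ Sum.inl = y ∘ Sum.inl then 1 else 0) * g.matrix (x ∘ Sum.inr) (y ∘ Sum.inr)
    by_cases hxy : x ∘ Sum.inl = y ∘ Sum.inl <;> simp [hxy]

theorem MatPreparable.mul_left {m m' : ℕ} {Ψ : Matrix (Bits κ) (Bits κ') ℂ}
    {W : Matrix (Bits κ) (Bits κ) ℂ} (h : MatPreparable m Ψ) (hW : Implements m' W) :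
    MatPreparable (m + m') (W * Ψ) := by
  have h2 := Preparable.mulVec h (hW.sum_left (κ' := κ'))
  rw [submatrix_mulVec_equiv] at h2
  unfold MatPreparable
  convert h2 using 1
  ext z
  change (W * Ψ) (z ∘ Sum.inl) (z ∘ Sum.inr) = ∑ p : Bits κ × Bits κ',
    (W (z ∘ Sum.inl) p.1 * (1 : Matrix (Bits κ') (Bits κ') ℂ) (z ∘ Sum.inr) p.2) * Ψ p.1 p.2
  simp [Fintype.sum_prod_type, one_apply, mul_apply]

theorem MatPreparable.mul_right {m m' : ℕ} {Ψ : Matrix (Bits κ) (Bits κ') ℂ}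
    {W : Matrix (Bits κ') (Bits κ') ℂ} (h : MatPreparable m Ψ) (hW : Implements m' W) :
    MatPreparable (m + m') (Ψ * Wᵀ) := by
  have h2 := Preparable.mulVec h (hW.sum_right (κ := κ))
  rw [submatrix_mulVec_equiv] at h2
  unfold MatPreparable
  convert h2 using 1
  ext z
  change (Ψ * Wᵀ) (z ∘ Sum.inl) (z ∘ Sum.inr) = ∑ p : Bits κ × Bits κ',
    ((1 : Matrix (Bits κ) (Bits κ) ℂ) (z ∘ Sum.inl) p.1 * W (z ∘ Sum.inr) p.2) * Ψ p.1 p.2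
  rw [Fintype.sum_prod_type, Finset.sum_eq_single (z ∘ Sum.inl)]
  · simp [mul_apply, mul_comm]
  · intro x _ hx
    simp [one_apply, Ne.symm hx]
  · simp

/-- A state on the first register, with the second register in `|0…0⟩`. -/
theorem Preparable.matPreparable {m : ℕ} {φ : Bits κ → ℂ} (h : Preparable m φ) :
    MatPreparable (κ' := κ') m (of fun x y => if y = 0 then φ x else 0) := by
  obtain ⟨W, hW, rfl⟩ := preparable_iff.1 h
  have h0 : MatPreparable (κ := κ) (κ' := κ') 0 (of fun x y => if x = 0 ∧ y = 0 then 1 else 0) := by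
    refine preparable_iff.2 ⟨1, Implements.one, ?_⟩
    rw [one_mulVec]
    ext z
    have hz : z = 0 ↔ z ∘ Sum.inl = 0 ∧ z ∘ Sum.inr = 0 := by
      simp [funext_iff, Sum.forall]
    simp [zeroKet, Pi.single_apply, hz]
  have h1 := h0.mul_left hW
  rw [zero_add] at h1
  convert h1 using 1
  ext x y
  by_cases hy : y = 0
  · simp [hy, mul_apply, zeroKet]
  · simp [hy, mul_apply]

theorem Gate.cnot_mulVec (c t : ι) (hct : c ≠ t) (ψ : Bits ι → ℂ) (x : Bits ι) :
    ((Gate.cnot c t hct).matrix *ᵥ ψ) x = ψ (Function.update x t (x t + x c)) := by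
  have hinv : ∀ a b : Bits ι, a = Function.update b t (b t + b c) →
      b = Function.update a t (a t + a c) := by
    rintro _ b rfl
    ext j
    by_cases hj : j = t
    · subst hj
      simp only [Function.update_self, Function.update_of_ne hct]
      generalize b j = p
      generalize b c = q
      revert p q
      decide
    · simp [Function.update_of_ne hj]
  have h : ∀ y, x = Function.update y t (y t + y c) ↔ y = Function.update x t (x t + x c) :=
    fun y => ⟨hinv x y, hinv y x⟩
  simp [mulVec, dotProduct, Gate.matrix, h]

/-- Copying the basis states of the first register into the second one along the injection `g`, by
one C-NOT for each qubit. -/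
theorem MatPreparable.fanout {m : ℕ} {φ : Bits κ → ℂ} (g : κ → κ') (hg : Function.Injective g)
    (h : MatPreparable (κ' := κ') m (of fun x y => if y = 0 then φ x else 0)) :
    MatPreparable (m + Fintype.card κ)
      (of fun x y => if y = Function.extend g x 0 then φ x else 0) := by
  suffices H : ∀ S : Finset κ, MatPreparable (m + S.card) (of fun (x : Bits κ) (y : Bits κ') =>
      if y = Function.extend g (fun j => if j ∈ S then x j else 0) 0 then φ x else 0) by
    simpa using H Finset.univ
  intro S
  induction S using Finset.induction_on with
  | empty =>
    have : Function.extend g (fun _ => (0 : Fin 2)) 0 = 0 := by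
      ext j'
      by_cases hj : ∃ j, g j = j'
      · obtain ⟨j, rfl⟩ := hj
        simp [hg.extend_apply]
      · simp [Function.extend_apply' _ _ _ hj]
    simpa [this] using h
  | insert j S hj ih =>
    have h2 := Preparable.mulVec ih (Implements.cnot (Sum.inl j) (Sum.inr (g j)) (by simp))
    rw [Finset.card_insert_of_notMem hj, ← add_assoc]
    unfold MatPreparable
    convert h2 using 1
    ext z
    rw [Gate.cnot_mulVec]
    obtain ⟨x, hx⟩ : ∃ x, x = z ∘ Sum.inl := ⟨_, rfl⟩
    obtain ⟨y, hy⟩ : ∃ y, y = z ∘ Sum.inr := ⟨_, rfl⟩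
    have e1 : Function.update z (Sum.inr (g j)) (z (Sum.inr (g j)) + z (Sum.inl j)) ∘ Sum.inl
        = x := by
      ext k; simp [hx]
    have e2 : Function.update z (Sum.inr (g j)) (z (Sum.inr (g j)) + z (Sum.inl j)) ∘ Sum.inr
        = Function.update y (g j) (y (g j) + x j) := by
      ext k
      by_cases hk : k = g j
      · subst hk; simp [hx, hy]
      · simp [hy, Function.update_of_ne hk]
    rw [e1, e2, ← hx, ← hy]
    simp only [of_apply]
    refine if_congr ?_ rfl rfl
    set E := Function.extend g (fun i => if i ∈ S then x i else 0) 0 with hE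
    have hE0 : E (g j) = 0 := by rw [hE, hg.extend_apply, if_neg hj]
    have hE' : Function.extend g (fun i => if i ∈ insert j S then x i else 0) 0
        = Function.update E (g j) (x j) := by
      ext k
      by_cases hk : k = g j
      · subst hk; simp [hg.extend_apply]
      · rw [Function.update_of_ne hk, hE]
        by_cases hk' : ∃ i, g i = k
        · obtain ⟨i, rfl⟩ := hk'
          have : i ≠ j := fun e => hk (congrArg g e)
          simp [hg.extend_apply, this]
        · simp [Function.extend_apply' _ _ _ hk']
    rw [hE']
    constructor
    · rintro rfl
      ext k
      by_cases hk : k = g j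
      · subst hk
        simp only [Function.update_self, hE0]
        generalize x j = p
        revert p
        decide
      · simp [Function.update_of_ne hk]
    · intro h
      ext k
      by_cases hk : k = g j
      · subst hk
        have h3 := congrFun h (g j)
        rw [Function.update_self, hE0] at h3
        rw [Function.update_self]
        revert h3
        generalize x j = p
        generalize y (g j) = q
        revert p q
        decide
      · have h3 := congrFun h k
        rw [Function.update_of_ne hk] at h3
        rw [Function.update_of_ne hk, h3]

theorem isState_sum_iff (ψ : Bits (κ ⊕ κ') → ℂ) :
    IsState ψ ↔ ∑ x, ∑ y, ‖ψ ((sumSplit κ κ').symm (x, y))‖ ^ 2 = 1 := by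
  rw [IsState, ← (sumSplit κ κ').symm.sum_comp, Fintype.sum_prod_type]

/-- Register halving, equal halves. The diagonals left over by the two unitaries act on the Schmidt
basis and are absorbed into the Schmidt coefficients. -/
theorem preparable_sum_self {u N : ℕ} (hu : UpToDiagonal κ u)
    (hN : ∀ φ : Bits κ → ℂ, IsState φ → Preparable N φ) (ψ : Bits (κ ⊕ κ) → ℂ) (hψ : IsState ψ) :
    Preparable (N + Fintype.card κ + u + u) ψ := by
  set Ψ : Matrix (Bits κ) (Bits κ) ℂ := of fun x y => ψ ((sumSplit κ κ).symm (x, y)) with hΨ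
  obtain ⟨R, hR, s, -, hgram⟩ := exists_gram_diagonalization Ψᵀ
  obtain ⟨A, hA, hAR⟩ := exists_unitary_mul_of_gram_eq
    (hgram.trans (diagonal_conjTranspose_mul_self s R).symm)
  obtain ⟨W₁, hW₁, d₁, hd₁, e₁⟩ := hu _ (transpose_mem_unitaryGroup hR)
  obtain ⟨W₂, hW₂, d₂, hd₂, e₂⟩ := hu _ hA
  have hφ : IsState fun x => d₁ x * s x * d₂ x := by
    have h1 := sum_sq_eq_of_gram hR hgram
    simp only [IsState, norm_mul, hd₁, hd₂, one_mul, mul_one, Complex.norm_real, Real.norm_eq_abs,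
      sq_abs]
    rw [h1, Finset.sum_comm]
    exact (isState_sum_iff ψ).1 hψ
  have h := (((hN _ hφ).matPreparable.fanout id Function.injective_id).mul_left hW₁).mul_right hW₂
  have hdiag : (of fun x y : Bits κ => if y = Function.extend id x 0 then d₁ x * s x * d₂ x else 0)
      = diagonal d₁ * diagonal (fun x => (s x : ℂ)) * diagonal d₂ := by
    rw [diagonal_mul_diagonal, diagonal_mul_diagonal]
    ext x y
    have : Function.extend id x 0 = x := funext fun j =>
      Function.injective_id.extend_apply x 0 j
    rw [of_apply, this, diagonal_apply]
    exact if_congr eq_comm rfl rfl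
  rw [hdiag] at h
  have hfin : W₁ * (diagonal d₁ * diagonal (fun x => (s x : ℂ)) * diagonal d₂) * W₂ᵀ = Ψ := by
    have h2 := congrArg transpose hAR
    rw [transpose_transpose, transpose_mul, transpose_mul, e₁, e₂, transpose_mul,
      diagonal_transpose, diagonal_transpose] at h2
    rw [h2]
    simp only [Matrix.mul_assoc]
  rw [hfin] at h
  unfold MatPreparable at h
  convert h using 1
  ext z
  rw [hΨ, of_apply]
  congr 1
  exact ((sumSplit κ κ).symm_apply_apply z).symm

/-- Register halving when the second half has one more qubit: only an isometry is needed there. -/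
theorem preparable_sum_option {u v N : ℕ} (hu : UpToDiagonal κ u) (hv : ColumnUpToDiagonal κ v)
    (hN : ∀ φ : Bits κ → ℂ, IsState φ → Preparable N φ) (ψ : Bits (κ ⊕ Option κ) → ℂ)
    (hψ : IsState ψ) : Preparable (N + Fintype.card κ + u + v) ψ := by
  set Ψ : Matrix (Bits κ) (Bits (Option κ)) ℂ :=
    of fun x y => ψ ((sumSplit κ (Option κ)).symm (x, y)) with hΨ
  set P : Matrix (Bits κ ⊕ Bits κ) (Bits κ) ℂ := Ψᵀ.submatrix (topSplit κ).symm id with hP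
  obtain ⟨R, hR, s, -, hgram⟩ := exists_gram_diagonalization P
  -- pad with zero columns to get square matrices
  obtain ⟨A, hA, hAR⟩ := exists_unitary_mul_of_gram_eq
    (M := fromBlocks P.toRows₁ 0 P.toRows₂ 0)
    (N := fromBlocks (diagonal (fun i => (s i : ℂ)) * R) 0 0 0) (by
      have h1 : P.toRows₁ᴴ * P.toRows₁ + P.toRows₂ᴴ * P.toRows₂ = Pᴴ * P := by
        ext i j
        simp [mul_apply, toRows₁, toRows₂]
      simp only [fromBlocks_conjTranspose, fromBlocks_multiply, conjTranspose_zero,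
        Matrix.zero_mul, Matrix.mul_zero, add_zero, h1, hgram, diagonal_conjTranspose_mul_self])
  obtain ⟨W₁, hW₁, d₁, hd₁, e₁⟩ := hu _ (transpose_mem_unitaryGroup hR)
  obtain ⟨Y, hY, d₂, hd₂, e₂⟩ := hv _ hA
  have hφ : IsState fun x => d₁ x * s x * d₂ x := by
    have h1 := sum_sq_eq_of_gram hR hgram
    simp only [IsState, norm_mul, hd₁, hd₂, one_mul, mul_one, Complex.norm_real, Real.norm_eq_abs,
      sq_abs]
    rw [h1, Finset.sum_comm, ← (isState_sum_iff ψ).1 hψ]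
    refine Finset.sum_congr rfl fun x _ => ?_
    exact (topSplit κ).symm.sum_comp fun y => ‖Ψ x y‖ ^ 2
  have h := (((hN _ hφ).matPreparable.fanout some (Option.some_injective κ)).mul_left hW₁).mul_right
    hY
  have hPY : P = Y * fromRows (diagonal d₂ * diagonal (fun i => (s i : ℂ)) * R)
      (0 : Matrix (Bits κ) (Bits κ) ℂ) := by
    have h2 : fromBlocks P.toRows₁ 0 P.toRows₂ 0 = Y * fromBlocks
        (diagonal d₂ * diagonal (fun i => (s i : ℂ)) * R) 0 0 0 := by
      calc _ = A * fromBlocks 1 0 0 0 * fromBlocks (diagonal (fun i => (s i : ℂ)) * R) 0 0 0 := by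
            rw [hAR, Matrix.mul_assoc, fromBlocks_multiply]; simp
        _ = _ := by
            rw [e₂, Matrix.mul_assoc, fromBlocks_multiply]
            simp only [Matrix.mul_assoc, Matrix.mul_zero, Matrix.zero_mul, add_zero]
    ext x y
    have h3 := congrFun (congrFun h2 x) (Sum.inl y)
    have h4 : fromBlocks P.toRows₁ 0 P.toRows₂ (0 : Matrix (Bits κ) (Bits κ) ℂ) x (Sum.inl y)
        = P x y := by
      rcases x with x | x <;> rfl
    rw [← h4, h3, mul_apply, mul_apply]
    refine Finset.sum_congr rfl fun k _ => ?_
    rcases k with k | k <;> rfl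
  have hfin : W₁ * (of fun (x : Bits κ) (y : Bits (Option κ)) =>
      if y = Function.extend some x 0 then d₁ x * s x * d₂ x else 0)
        * (Y.submatrix (topSplit κ) (topSplit κ))ᵀ = Ψ := by
    have hQ : (of fun (x : Bits κ) (y : Bits (Option κ)) =>
        if y = Function.extend some x 0 then d₁ x * s x * d₂ x else 0)
        = diagonal d₁ * ((fromRows (diagonal d₂ * diagonal (fun i => (s i : ℂ)))
          (0 : Matrix (Bits κ) (Bits κ) ℂ)).submatrix (topSplit κ) id)ᵀ := by
      have hext : ∀ x : Bits κ, Function.extend some x 0 = (topSplit κ).symm (Sum.inl x) := by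
        intro x
        ext o
        cases o with
        | none => rw [Function.extend_apply' _ _ _ (by simp)]; rfl
        | some k => rw [(Option.some_injective κ).extend_apply]; rfl
      ext x y
      obtain ⟨y, rfl⟩ := (topSplit κ).symm.surjective y
      rw [of_apply, diagonal_mul, transpose_apply, submatrix_apply, Equiv.apply_symm_apply, hext,
        diagonal_mul_diagonal]
      rcases y with y | y
      · by_cases hxy : y = x
        · subst hxy; simp; ring
        · simp [hxy]
      · simp
    rw [hQ]
    have h5 : Ψᵀ = P.submatrix (topSplit κ) id := by
      rw [hP, submatrix_submatrix, Equiv.symm_comp_self]; rfl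
    have h6 : fromRows (diagonal d₂ * diagonal (fun i => (s i : ℂ)) * R)
        (0 : Matrix (Bits κ) (Bits κ) ℂ)
        = fromRows (diagonal d₂ * diagonal (fun i => (s i : ℂ)))
          (0 : Matrix (Bits κ) (Bits κ) ℂ) * R := by
      rw [fromRows_mul, Matrix.zero_mul]
    have h7 := congrArg transpose h5
    rw [transpose_transpose, hPY, h6, ← submatrix_mul_equiv _ _ _ (topSplit κ), transpose_mul,
      show (fromRows (diagonal d₂ * diagonal (fun i => (s i : ℂ)))
          (0 : Matrix (Bits κ) (Bits κ) ℂ) * R).submatrix (topSplit κ) id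
        = (fromRows (diagonal d₂ * diagonal (fun i => (s i : ℂ)))
          (0 : Matrix (Bits κ) (Bits κ) ℂ)).submatrix (topSplit κ) id * R from rfl,
      transpose_mul, e₁] at h7
    rw [h7]
    simp only [Matrix.mul_assoc]
  rw [hfin] at h
  unfold MatPreparable at h
  convert h using 1
  ext z
  rw [hΨ, of_apply]
  congr 1
  exact ((sumSplit κ (Option κ)).symm_apply_apply z).symm

end States

/-! ### The count -/

/-- A one-qubit state is prepared by a single gate. -/
theorem preparable_one (ψ : Bits (Fin 1) → ℂ) (hψ : IsState ψ) : Preparable 0 ψ := by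
  have hsum : ‖ψ (fun _ => 0)‖ ^ 2 + ‖ψ (fun _ => 1)‖ ^ 2 = 1 := by
    rw [← hψ, ← (Equiv.funUnique (Fin 1) (Fin 2)).symm.sum_comp, Fin.sum_univ_two]
    rfl
  obtain ⟨a, ha, -, hu⟩ := TwoQubit.exists_special_unitary_column (u := fun i => ψ fun _ => i) hsum
  refine preparable_iff.2 ⟨_, Implements.single 0 ⟨a, ha⟩, ?_⟩
  ext x
  have hx : (fun _ => x 0) = x := funext fun j => by rw [Subsingleton.elim j 0]
  rw [zeroKet, mulVec_single_one]
  simp only [Gate.matrix, col_apply, of_apply]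
  rw [if_pos fun j hj => (hj (Subsingleton.elim j 0)).elim, Pi.zero_apply, hu, hx]

theorem IsState.comp_equiv {ι κ : Type*} [Fintype ι] [DecidableEq ι] [Fintype κ] [DecidableEq κ]
    {ψ : Bits ι → ℂ} (h : IsState ψ) (e : κ ≃ ι) : IsState (ψ ∘ (bitsCongr e).symm) := by
  rw [IsState, ← h]
  exact (bitsCongr e).symm.sum_comp fun x => ‖ψ x‖ ^ 2

/-- Preparability of all states only depends on the number of qubits. -/
theorem forall_preparable_congr {ι κ : Type*} [Fintype ι] [DecidableEq ι] [Fintype κ]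
    [DecidableEq κ] {N : ℕ} (e : κ ≃ ι) (h : ∀ φ : Bits κ → ℂ, IsState φ → Preparable N φ)
    (ψ : Bits ι → ℂ) (hψ : IsState ψ) : Preparable N ψ := by
  have h2 := (h _ (hψ.comp_equiv e)).congr e
  rwa [Function.comp_assoc, Equiv.symm_comp_self, Function.comp_id] at h2

theorem bitLength_eq_div_two {n : ℕ} (hn : 2 ≤ n) : bitLength n = bitLength (n / 2) + 1 := by
  rw [bitLength, bitLength, Nat.log_of_one_lt_of_le one_lt_two hn]

/-- The recursion satisfied by the closed form: one halving of the register. -/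
theorem nState_eq_div_two {n : ℕ} (hn : 4 ≤ n) :
    nState n = 11 / 12 * 2 ^ n - cCoeff n * 2 ^ (n / 2) + ((n / 2 : ℕ) : ℚ) + dCoeff n
      + nState (n / 2) := by
  have hl : bitLength n = bitLength (n / 2) + 1 := bitLength_eq_div_two (by omega)
  have hl2 : bitLength (n / 2) = bitLength (n / 2 / 2) + 1 := bitLength_eq_div_two (by omega)
  have hl3 : 1 ≤ bitLength (n / 2 / 2) := by simp [bitLength]
  obtain ⟨m, hm⟩ : ∃ m, bitLength (n / 2) = m + 2 := ⟨bitLength (n / 2) - 2, by omega⟩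
  have hd : ∀ i, n / 2 ^ (i + 1) = n / 2 / 2 ^ i := fun i => by
    rw [pow_succ', Nat.div_div_eq_div_mul]
  have htop : topTwoBits n = topTwoBits (n / 2) := by
    rw [topTwoBits, topTwoBits, hl, hm, show m + 2 + 1 - 2 = m + 1 by omega, hd]
    rfl
  have hpop : popcount n = n % 2 + popcount (n / 2) := by
    rw [popcount, popcount, Nat.digits_def' one_lt_two (by omega), List.sum_cons]
  have hmod : (n : ℚ) = 2 * ((n / 2 : ℕ) : ℚ) + ((n % 2 : ℕ) : ℚ) := by
    exact_mod_cast (Nat.div_add_mod n 2).symm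
  rw [nState, nState, htop, hpop, hl, hm, show m + 2 + 1 - 2 = m + 1 by omega,
    show m + 2 - 2 = m by omega, Finset.sum_range_succ', Finset.sum_range_succ',
    Finset.sum_range_succ']
  simp only [hd, pow_zero, Nat.div_one]
  rw [hmod]
  push_cast
  ring

theorem log_two_eq_one {n : ℕ} (h2 : 2 ≤ n) (h3 : n ≤ 3) : Nat.log 2 n = 1 :=
  (Nat.log_eq_iff (by simp)).2 ⟨by omega, by omega⟩

theorem nState_two : nState 2 = 1 := by
  have h : bitLength 2 = 2 := by rw [bitLength, log_two_eq_one le_rfl (by norm_num)]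
  rw [nState, topTwoBits, h, popcount]
  norm_num

theorem nState_three : nState 3 = 3 := by
  have h : bitLength 3 = 2 := by rw [bitLength, log_two_eq_one (by norm_num) le_rfl]
  rw [nState, topTwoBits, h, popcount]
  norm_num

theorem nState_lt {n : ℕ} (hn : 2 ≤ n) : nState n < 11 / 12 * 2 ^ n := by
  induction n using Nat.strong_induction_on with
  | _ n ih =>
    rcases Nat.lt_or_ge n 4 with h4 | h4
    · interval_cases n
      · rw [nState_two]; norm_num
      · rw [nState_three]; norm_num
    · have h := ih (n / 2) (by omega) (by omega)
      rw [nState_eq_div_two h4]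
      have hc : (3 : ℚ) ≤ cCoeff n := by rw [cCoeff]; split_ifs <;> norm_num
      have hd : dCoeff n ≤ 5 / 3 := by rw [dCoeff]; split_ifs <;> norm_num
      have hlt : ((n / 2 : ℕ) : ℚ) + 1 ≤ 2 ^ (n / 2) := by
        exact_mod_cast Nat.lt_two_pow_self (n := n / 2)
      have h4' : (4 : ℚ) ≤ 2 ^ (n / 2) := by
        calc (4 : ℚ) = 2 ^ 2 := by norm_num
          _ ≤ 2 ^ (n / 2) := pow_le_pow_right₀ (by norm_num) (by omega)
      nlinarith

/-- Every `n`-qubit state is prepared with exactly `nState n` C-NOT gates. -/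
theorem exists_preparable {n : ℕ} (hn : 2 ≤ n) :
    ∃ N : ℕ, (N : ℚ) = nState n ∧ ∀ ψ : Bits (Fin n) → ℂ, IsState ψ → Preparable N ψ := by
  induction n using Nat.strong_induction_on with
  | _ n ih =>
    rcases Nat.lt_or_ge n 4 with h4 | h4
    · interval_cases n
      · refine ⟨1, by rw [nState_two]; norm_num, ?_⟩
        exact forall_preparable_congr (Fintype.equivOfCardEq (by simp))
          (preparable_sum_self upToDiagonal_one preparable_one)
      · refine ⟨3, by rw [nState_three]; norm_num, ?_⟩
        have h2 : UpToDiagonal (Option (Fin 1)) 2 :=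
          upToDiagonal_two.congr (Fintype.equivOfCardEq (by simp))
        exact forall_preparable_congr (Fintype.equivOfCardEq (by simp))
          (preparable_sum_option upToDiagonal_one h2.column_of_option preparable_one)
    · obtain ⟨M, hM, hprep⟩ := ih (n / 2) (by omega) (by omega)
      obtain ⟨k, hk⟩ : ∃ k, n / 2 = k + 2 := ⟨n / 2 - 2, by omega⟩
      rw [nState_eq_div_two h4, ← hM]
      rw [hk] at hprep ⊢
      have hu := upToDiagonal_fin (k + 1)
      have hcount : 24 * (unitaryCount (k + 2) : ℚ) + 36 * 2 ^ (k + 2)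
          = 11 * (2 ^ (k + 2)) ^ 2 + 16 := by
        rw [← pow_mul, mul_comm (k + 2) 2, pow_mul]
        norm_num
        exact_mod_cast unitaryCount_closed_form k
      rcases Nat.even_or_odd n with hpar | hpar
      · have hn2 : n = 2 * (k + 2) := by obtain ⟨r, rfl⟩ := hpar; omega
        refine ⟨_, ?_, forall_preparable_congr (Fintype.equivOfCardEq ?_)
          (preparable_sum_self hu hprep)⟩
        · have hpow : (2 : ℚ) ^ n = (2 ^ (k + 2)) ^ 2 := by rw [hn2, mul_comm, pow_mul]
          rw [hpow, cCoeff, dCoeff, if_pos hpar, if_pos hpar, Fintype.card_fin]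
          push_cast
          linear_combination hcount / 12
        · simp only [Fintype.card_sum, Fintype.card_fin]
          omega
      · have hn2 : n = 2 * (k + 2) + 1 := by obtain ⟨r, rfl⟩ := hpar; omega
        have hne : ¬ Even n := Nat.not_even_iff_odd.2 hpar
        refine ⟨_, ?_, forall_preparable_congr (Fintype.equivOfCardEq ?_)
          (preparable_sum_option hu hu.column hprep)⟩
        · have hpow : (2 : ℚ) ^ n = 2 * (2 ^ (k + 2)) ^ 2 := by
            rw [hn2, pow_succ, mul_comm 2 (k + 2), pow_mul, mul_comm]
          rw [hpow, cCoeff, dCoeff, if_neg hne, if_neg hne, Fintype.card_fin]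
          have hpos : 1 ≤ 3 * unitaryCount (k + 2) + 2 * 2 ^ (k + 2) :=
            le_add_left (Nat.mul_pos two_pos (by positivity))
          rw [show k + 1 + 1 = k + 2 from rfl]
          push_cast [Nat.cast_sub hpos]
          linear_combination hcount / 6
        · simp only [Fintype.card_sum, Fintype.card_fin, Fintype.card_option]
          omega

end StatePrep

end

theorem theorem1 (n : ℕ) (hn : 1 ≤ n) :
    (∀ ψ : StatePrep.Bits (Fin n) → ℂ, StatePrep.IsState ψ →
      ∃ C : StatePrep.Circuit (Fin n),
        C.Prepares ψ ∧ (C.cnotCount : ℚ) ≤ 11 / 12 * 2 ^ n) ∧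
    (2 ≤ n →
      StatePrep.nState n < 11 / 12 * 2 ^ n ∧
      ∀ ψ : StatePrep.Bits (Fin n) → ℂ, StatePrep.IsState ψ →
        ∃ C : StatePrep.Circuit (Fin n),
          C.Prepares ψ ∧ (C.cnotCount : ℚ) = StatePrep.nState n) := by
  have hmain : 2 ≤ n → ∀ ψ : StatePrep.Bits (Fin n) → ℂ, StatePrep.IsState ψ →
      ∃ C : StatePrep.Circuit (Fin n),
        C.Prepares ψ ∧ (C.cnotCount : ℚ) = StatePrep.nState n := by
    intro h2 ψ hψ
    obtain ⟨N, hN, hprep⟩ := StatePrep.exists_preparable h2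
    obtain ⟨C, hC, hCN⟩ := hprep ψ hψ
    exact ⟨C, hC, by rw [hCN, hN]⟩
  refine ⟨fun ψ hψ => ?_, fun h2 => ⟨StatePrep.nState_lt h2, hmain h2⟩⟩
  rcases Nat.lt_or_ge n 2 with h1 | h2
  · obtain rfl : n = 1 := by omega
    obtain ⟨C, hC, hC0⟩ := StatePrep.preparable_one ψ hψ
    exact ⟨C, hC, by rw [hC0]; norm_num⟩
  · obtain ⟨C, hC, hCN⟩ := hmain h2 ψ hψ
    exact ⟨C, hC, by rw [hCN]; exact (StatePrep.nState_lt h2).le⟩
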